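/- Let $1\le k<n$, let $\mathbf x_1,\dots,\mathbf x_n\in\mathbb R^k$ be observed values of random vectors that, given $(\boldsymbol\mu,\boldsymbol\Sigma)$ with $\boldsymbol\Sigma$ positive definite, are independent and $\mathcal N_k(\boldsymbol\mu,\boldsymbol\Sigma)$-distributed, and let $\mathbf L$ be a $p\times k$ real matrix of constants. Put $$\overline{\mathbf x}_d=\frac1n\sum_{i=1}^n\mathbf x_i,\qquad \mathbf S_d=\sum_{i=1}^n(\mathbf x_i-\overline{\mathbf x}_d)(\mathbf x_i-\overline{\mathbf x}_d)^\top .$$ For $0\le t<T$, risk aversion $\gamma>0$, wealth $W_t$ at time $t$ and risk-free returns $r_{f,i}$, the multi-period optimal portfolio weights under exponential utility are $$\mathbf w_t=C_t\,\boldsymbol\Sigma^{-1}(\boldsymbol\mu-r_{f,t+1}\mathbf 1),\qquad C_t=\Big(\gamma W_t\prod_{i=t+2}^{T}(1+r_{f,i})\Big)^{-1}.$$ The distribution of $\mathbf L\mathbf w_t$ is taken under the posterior of $(\boldsymbol\mu,\boldsymbol\Sigma)$ given $\mathbf x_1,\dots,\mathbf x_n$, i.e. the probability distribution whose density with respect to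 $d\boldsymbol\mu\prod_{i\le j}d\sigma_{ij}$ on the set of $(\boldsymbol\mu,\boldsymbol\Sigma)$ with $\boldsymbol\Sigma$ positive definite is proportional to likelihood times prior. Matrix square roots are the positive semidefinite ones, and $\mathbf A^{-1/2}=(\mathbf A^{1/2})^{-1}$. For $\mathbf b\in\mathbb R^k$, a positive definite $k\times k$ matrix $\mathbf S$, $N>0$, $q\ge0$ and a unit vector $\mathbf u\in\mathbb R^k$ put $$\epsilon=\mathbf b^\top\mathbf S^{-1}\mathbf b+\frac{2}{\sqrt N}\frac{\sqrt q}{1+q}\,\mathbf b^\top\mathbf S^{-1/2}\mathbf u+\frac1N\frac{q}{1+q}-\frac{q}{1+q}\big(\mathbf b^\top\mathbf S^{-1/2}\mathbf u\big)^2,$$ $$\boldsymbol\zeta=\mathbf S^{-1}\mathbf b+\frac1{\sqrt N}\frac{\sqrt q}{1+q}\,\mathbf S^{-1/2}\mathbf u-\frac q{1+q}\,\mathbf S^{-1/2}\mathbf u\mathbf u^\top\mathbf S^{-1/2}\mathbf b,\qquad \boldsymbol\Upsilon=\mathbf S^{-1}-\frac q{1+q}\,\mathbf S^{-1/2}\mathbf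 u\mathbf u^\top\mathbf S^{-1/2}.$$ (a) Diffuse prior. Let $\pi(\boldsymbol\mu,\boldsymbol\Sigma)\propto|\boldsymbol\Sigma|^{-(k+1)/2}$ and let $\mathbf S_d$ be positive definite. Then $$\mathbf L\mathbf w_t\stackrel{d}{=}C_t\,\eta\,\mathbf L\boldsymbol\zeta+C_t\sqrt\eta\,\big(\epsilon\,\mathbf L\boldsymbol\Upsilon\mathbf L^\top-\mathbf L\boldsymbol\zeta\boldsymbol\zeta^\top\mathbf L^\top\big)^{1/2}\mathbf z_0 ,$$ where $\epsilon,\boldsymbol\zeta,\boldsymbol\Upsilon$ are taken at $\mathbf b=\overline{\mathbf x}_d-r_{f,t+1}\mathbf 1$, $\mathbf S=\mathbf S_d$, $N=n$, $q=kQ/(n-k)$ and the random vector $\mathbf u$; here $\eta\sim\chi^2_n$, $\mathbf z_0\sim\mathcal N_p(\mathbf 0,\mathbf I_p)$, $Q\sim\mathcal F(k,n-k)$, $\mathbf u$ is uniformly distributed on the unit sphere in $\mathbb R^k$, and $\eta,\mathbf z_0,Q,\mathbf u$ are mutually independent. (b) Conjugate prior. Let $\boldsymbol\mu\mid\boldsymbol\Sigma\sim\mathcal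 N_k(\mathbf m_0,\boldsymbol\Sigma/r_0)$ and $\boldsymbol\Sigma\sim\mathcal{IW}_k(d_0,\mathbf S_0)$, with $\mathbf m_0\in\mathbb R^k$, $r_0>0$, real $d_0>2k$ and $\mathbf S_0$ positive definite, where $\mathcal{IW}_k(d_0,\mathbf S_0)$ has density proportional to $|\boldsymbol\Sigma|^{-d_0/2}\exp(-\tfrac12\operatorname{tr}(\boldsymbol\Sigma^{-1}\mathbf S_0))$. Put $$\overline{\mathbf x}_c=\frac{n\overline{\mathbf x}_d+r_0\mathbf m_0}{n+r_0},\qquad \mathbf S_c=\mathbf S_d+\mathbf S_0+\frac{nr_0}{n+r_0}(\mathbf m_0-\overline{\mathbf x}_d)(\mathbf m_0-\overline{\mathbf x}_d)^\top .$$ Then the same representation of $\mathbf L\mathbf w_t$ holds with $\epsilon,\boldsymbol\zeta,\boldsymbol\Upsilon$ taken at $\mathbf b=\overline{\mathbf x}_c-r_{f,t+1}\mathbf 1$, $\mathbf S=\mathbf S_c$, $N=n+r_0$, $q=kQ/(n+d_0-2k)$ and the random vector $\mathbf u$; here $\eta\sim\chi^2_{n+d_0-k}$, $\mathbf z_0\sim\mathcal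 N_p(\mathbf 0,\mathbf I_p)$, $Q\sim\mathcal F(k,n+d_0-2k)$, $\mathbf u$ is uniformly distributed on the unit sphere in $\mathbb R^k$, and $\eta,\mathbf z_0,Q,\mathbf u$ are mutually independent. -/

import Mathlib

open MeasureTheory ProbabilityTheory Matrix
open scoped MatrixOrder ENNReal

noncomputable section

namespace BayesPortfolio

/-! ### Parameter space of the normal model -/

/-- Positions `(i, j)` with `i ≤ j`: the free entries of a symmetric `k × k` matrix. -/
abbrev UpperIdx (k : ℕ) : Type := {ij : Fin k × Fin k // ij.1 ≤ ij.2}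

/-- The symmetric matrix with the given entries on and above the diagonal. -/
def symMatrix {k : ℕ} (s : UpperIdx k → ℝ) : Matrix (Fin k) (Fin k) ℝ :=
  Matrix.of fun i j =>
    if h : i ≤ j then s ⟨(i, j), h⟩ else s ⟨(j, i), (not_le.mp h).le⟩

/-- A parameter `(μ, Σ)`: the mean vector, and the free entries of the symmetric matrix `Σ`.
The volume on this type is the Lebesgue measure `dμ ∏_{i ≤ j} dσ_{ij}`. -/
abbrev Param (k : ℕ) : Type := (Fin k → ℝ) × (UpperIdx k → ℝ)

/-- The mean vector `μ`. -/
def Param.mean {k : ℕ} (θ : Param k) : Fin k → ℝ := θ.1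

/-- The covariance matrix `Σ`. -/
def Param.cov {k : ℕ} (θ : Param k) : Matrix (Fin k) (Fin k) ℝ := symMatrix θ.2

/-- Lebesgue measure on the parameters `(μ, Σ)` with `Σ` positive definite. -/
def paramVolume (k : ℕ) : Measure (Param k) :=
  (volume : Measure (Param k)).restrict {θ | (Param.cov θ).PosDef}

/-! ### Densities -/

/-- Density at `y` of the normal distribution `N_k(m, V)`, for `V` positive definite. -/
def normalDensity {k : ℕ} (m : Fin k → ℝ) (V : Matrix (Fin k) (Fin k) ℝ) (y : Fin k → ℝ) : ℝ :=
  (2 * Real.pi) ^ (-(k : ℝ) / 2) * V.det ^ (-(1 : ℝ) / 2) *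
    Real.exp (-((y - m) ⬝ᵥ (V⁻¹ *ᵥ (y - m))) / 2)

/-- The multivariate gamma function `Γ_k(a)`. -/
def multivariateGamma (k : ℕ) (a : ℝ) : ℝ :=
  Real.pi ^ ((k : ℝ) * ((k : ℝ) - 1) / 4) * ∏ i : Fin k, Real.Gamma (a - (i : ℝ) / 2)

/-- Density at the positive definite matrix `V` of the inverse Wishart distribution `IW_k(d, S)`,
in the parametrization in which `V⁻¹` has the Wishart distribution `W_k(d - k - 1, S⁻¹)`.
It is a probability density for `d > 2k` and `S` positive definite. -/
def invWishartDensity {k : ℕ} (d : ℝ) (S V : Matrix (Fin k) (Fin k) ℝ) : ℝ :=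
  S.det ^ ((d - k - 1) / 2) /
      (2 ^ ((d - k - 1) * k / 2) * multivariateGamma k ((d - k - 1) / 2)) *
    V.det ^ (-d / 2) * Real.exp (-(V⁻¹ * S).trace / 2)

/-- Likelihood of the observations `x`, which are i.i.d. `N_k(μ, Σ)` given `(μ, Σ)`. -/
def likelihood {k n : ℕ} (x : Fin n → Fin k → ℝ) (θ : Param k) : ℝ :=
  ∏ i, normalDensity θ.mean θ.cov (x i)

/-- Jeffreys' (diffuse, improper) prior `|Σ|^{-(k+1)/2}`. -/
def diffusePrior (k : ℕ) (θ : Param k) : ℝ :=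
  θ.cov.det ^ (-((k : ℝ) + 1) / 2)

/-- The conjugate prior `μ | Σ ∼ N_k(m₀, Σ / r₀)`, `Σ ∼ IW_k(d₀, S₀)`. -/
def conjugatePrior {k : ℕ} (m₀ : Fin k → ℝ) (r₀ d₀ : ℝ) (S₀ : Matrix (Fin k) (Fin k) ℝ)
    (θ : Param k) : ℝ :=
  normalDensity m₀ (r₀⁻¹ • θ.cov) θ.mean * invWishartDensity d₀ S₀ θ.cov

/-- The measure with density likelihood times prior. -/
def unnormalizedPosterior {k n : ℕ} (prior : Param k → ℝ) (x : Fin n → Fin k → ℝ) :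
    Measure (Param k) :=
  (paramVolume k).withDensity fun θ => ENNReal.ofReal (likelihood x θ * prior θ)

/-- The posterior distribution of `(μ, Σ)` given the observations `x`: the probability measure
whose density is proportional to likelihood times prior. -/
def posteriorDist {k n : ℕ} (prior : Param k → ℝ) (x : Fin n → Fin k → ℝ) : Measure (Param k) :=
  (unnormalizedPosterior prior x Set.univ)⁻¹ • unnormalizedPosterior prior x

/-! ### Optimal portfolio weights -/

/-- `C_t = (γ W_t ∏_{i=t+2}^T (1 + r_{f,i}))⁻¹`, where `W` is the wealth at time `t`. -/
def portfolioConst (γ W : ℝ) (rf : ℕ → ℝ) (t T : ℕ) : ℝ :=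
  (γ * W * ∏ i ∈ Finset.Icc (t + 2) T, (1 + rf i))⁻¹

/-- The optimal weights `w_t = C_t Σ⁻¹ (μ - r_{f,t+1} 1)` as a function of `(μ, Σ)`. -/
def weights {k : ℕ} (γ W : ℝ) (rf : ℕ → ℝ) (t T : ℕ) (θ : Param k) : Fin k → ℝ :=
  portfolioConst γ W rf t T • ((θ.cov)⁻¹ *ᵥ (θ.mean - fun _ => rf (t + 1)))

/-! ### Posterior quantities -/

/-- The sample mean vector. -/
def sampleMean {k n : ℕ} (x : Fin n → Fin k → ℝ) : Fin k → ℝ :=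
  (n : ℝ)⁻¹ • ∑ i, x i

/-- The sample covariance matrix. -/
def sampleCov {k n : ℕ} (x : Fin n → Fin k → ℝ) : Matrix (Fin k) (Fin k) ℝ :=
  ((n : ℝ) - 1)⁻¹ • ∑ i, vecMulVec (x i - sampleMean x) (x i - sampleMean x)

/-- `S_{t,d}`, that is `n - 1` times the sample covariance matrix. -/
def scaleD {k n : ℕ} (x : Fin n → Fin k → ℝ) : Matrix (Fin k) (Fin k) ℝ :=
  ((n : ℝ) - 1) • sampleCov x

/-- The posterior location under the conjugate prior. -/
def meanC {k n : ℕ} (x : Fin n → Fin k → ℝ) (m₀ : Fin k → ℝ) (r₀ : ℝ) : Fin k → ℝ :=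
  ((n : ℝ) + r₀)⁻¹ • ((n : ℝ) • sampleMean x + r₀ • m₀)

/-- The posterior scale matrix `S_{t,c}` under the conjugate prior. -/
def scaleC {k n : ℕ} (x : Fin n → Fin k → ℝ) (m₀ : Fin k → ℝ) (r₀ : ℝ)
    (S₀ : Matrix (Fin k) (Fin k) ℝ) : Matrix (Fin k) (Fin k) ℝ :=
  scaleD x + S₀ +
    ((n : ℝ) * r₀ / ((n : ℝ) + r₀)) • vecMulVec (m₀ - sampleMean x) (m₀ - sampleMean x)

/-! ### Standard distributions -/

/-- The chi-square distribution with `ν` degrees of freedom. -/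
def chiSq (ν : ℝ) : Measure ℝ := gammaMeasure (ν / 2) (1 / 2)

/-- The `F`-distribution with `d₁` and `d₂` degrees of freedom, through its density. -/
def fisherF (d₁ d₂ : ℝ) : Measure ℝ :=
  volume.withDensity fun y => ENNReal.ofReal <|
    if 0 < y then
      (ProbabilityTheory.beta (d₁ / 2) (d₂ / 2))⁻¹ * (d₁ / d₂) ^ (d₁ / 2) *
        y ^ (d₁ / 2 - 1) * (1 + d₁ / d₂ * y) ^ (-(d₁ + d₂) / 2)
    else 0

/-- The unit sphere in `ℝ^k`. -/
abbrev UnitSphere (k : ℕ) : Type := Metric.sphere (0 : EuclideanSpace ℝ (Fin k)) 1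

/-- The uniform distribution on the unit sphere in `ℝ^k`: normalized surface measure. -/
def uniformSphere (k : ℕ) : Measure (UnitSphere k) :=
  ((volume : Measure (EuclideanSpace ℝ (Fin k))).toSphere Set.univ)⁻¹ •
    (volume : Measure (EuclideanSpace ℝ (Fin k))).toSphere

/-- The joint law of independent `η ∼ χ²_ν`, `z₀ ∼ N_p(0, I)`, `Q ∼ F(k, d)` and `u` uniform on
the unit sphere in `ℝ^k`. -/
def driverLaw (p k : ℕ) (ν d : ℝ) :
    Measure (ℝ × EuclideanSpace ℝ (Fin p) × ℝ × UnitSphere k) :=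
  (chiSq ν).prod ((stdGaussian (EuclideanSpace ℝ (Fin p))).prod
    ((fisherF k d).prod (uniformSphere k)))

/-! ### The functions in the representation

Here `b` is the posterior location minus `r_{f,t+1} 1`, `S` the posterior scale matrix, `N` is `n`
or `n + r₀`, and `q` stands for `k Q / d`. Square roots of matrices are the positive semidefinite
ones. -/

/-- `S^{-1/2}` for positive definite `S`. -/
def invSqrt {k : ℕ} (S : Matrix (Fin k) (Fin k) ℝ) : Matrix (Fin k) (Fin k) ℝ := (CFC.sqrt S)⁻¹

/-- The scalar `ε`. -/
def epsilonFun {k : ℕ} (b : Fin k → ℝ) (S : Matrix (Fin k) (Fin k) ℝ) (N q : ℝ)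
    (u : Fin k → ℝ) : ℝ :=
  b ⬝ᵥ (S⁻¹ *ᵥ b) + 2 / √N * (√q / (1 + q)) * (b ⬝ᵥ (invSqrt S *ᵥ u)) +
    1 / N * (q / (1 + q)) - q / (1 + q) * (b ⬝ᵥ (invSqrt S *ᵥ u)) ^ 2

/-- The vector `ζ`. -/
def zetaFun {k : ℕ} (b : Fin k → ℝ) (S : Matrix (Fin k) (Fin k) ℝ) (N q : ℝ)
    (u : Fin k → ℝ) : Fin k → ℝ :=
  S⁻¹ *ᵥ b + (1 / √N * (√q / (1 + q))) • (invSqrt S *ᵥ u) -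
    (q / (1 + q)) • ((invSqrt S * vecMulVec u u * invSqrt S) *ᵥ b)

/-- The matrix `Υ`. -/
def upsilonFun {k : ℕ} (S : Matrix (Fin k) (Fin k) ℝ) (q : ℝ) (u : Fin k → ℝ) :
    Matrix (Fin k) (Fin k) ℝ :=
  S⁻¹ - (q / (1 + q)) • (invSqrt S * vecMulVec u u * invSqrt S)

/-- `C η L ζ + C √η (ε L Υ Lᵀ - L ζ ζᵀ Lᵀ)^{1/2} z` with `ε`, `ζ`, `Υ` evaluated at `(q, u)`. -/
def representation {k p : ℕ} (C : ℝ) (L : Matrix (Fin p) (Fin k) ℝ) (b : Fin k → ℝ)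
    (S : Matrix (Fin k) (Fin k) ℝ) (N : ℝ) (η : ℝ) (z : Fin p → ℝ) (q : ℝ) (u : Fin k → ℝ) :
    Fin p → ℝ :=
  (C * η) • (L *ᵥ zetaFun b S N q u) +
    (C * √η) • (CFC.sqrt (epsilonFun b S N q u • (L * upsilonFun S q u * Lᵀ) -
      L * vecMulVec (zetaFun b S N q u) (zetaFun b S N q u) * Lᵀ) *ᵥ z)

end BayesPortfolio

end

open BayesPortfolio

/-
Under either prior the posterior is a normal–inverse-Wishart law. Given `μ`, the matrix `Σ` is
inverse Wishart with scale `A = S + N (μ - m)(μ - m)ᵀ`. A congruence by `A^{1/2}` followed by a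
rotation reduces the law of `L Σ⁻¹ v`, `v = μ - ρ`, to that of the first column of `Σ⁻¹` for an
inverse Wishart `Σ` with identity scale. In the coordinates `(a, g, M)`, where `M` is the lower
right block of `Σ`, `a` its Schur complement and `M g` the rest of the first column, that column is
`a⁻¹ (1, -g)`, `a⁻¹` is chi-square and `g` is Gaussian given `a`. This makes `L Σ⁻¹ v` a normal
mean–variance mixture with `ε = vᵀ A⁻¹ v`, `ζ = A⁻¹ v` and `Υ = A⁻¹`.

Integrating out `Σ` leaves `μ` with a multivariate t-distribution about `m`, so in polar coordinates
`μ - m = √(q / N) S^{1/2} u` with `u` uniform on the sphere and `q` a multiple of an independent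
`F` variable. Then `A = S + q S^{1/2} u uᵀ S^{1/2}`, and the Sherman–Morrison formula for `A⁻¹`
turns the parameters of the mixture into the stated `ε`, `ζ`, `Υ`.
-/

noncomputable section

namespace BayesPortfolio

/-! ### Measurability of matrix functions -/

section Measurability

variable {m n : Type*}

scoped instance instMeasurableSpaceMatrix : MeasurableSpace (Matrix m n ℝ) := MeasurableSpace.pi

scoped instance instBorelSpaceMatrix [Countable m] [Countable n] : BorelSpace (Matrix m n ℝ) :=
  inferInstanceAs (BorelSpace (m → n → ℝ))

scoped instance instSecondCountableTopologyMatrix [Countable m] [Countable n] :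
    SecondCountableTopology (Matrix m n ℝ) :=
  inferInstanceAs (SecondCountableTopology (m → n → ℝ))

variable {α l : Type*} [MeasurableSpace α]

@[fun_prop]
lemma measurable_matrix_mul [Finite l] [Fintype m] [Finite n] {f : α → Matrix l m ℝ}
    {g : α → Matrix m n ℝ} (hf : Measurable f) (hg : Measurable g) :
    Measurable fun a => f a * g a :=
  (continuous_fst.matrix_mul continuous_snd).measurable.comp (hf.prodMk hg)

@[fun_prop]
lemma measurable_matrix_mulVec [Finite m] [Fintype n] {f : α → Matrix m n ℝ} {g : α → n → ℝ}
    (hf : Measurable f) (hg : Measurable g) : Measurable fun a => f a *ᵥ g a :=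
  (continuous_fst.matrix_mulVec continuous_snd).measurable.comp (hf.prodMk hg)

@[fun_prop]
lemma measurable_vecMulVec [Finite m] [Finite n] {f : α → m → ℝ} {g : α → n → ℝ}
    (hf : Measurable f) (hg : Measurable g) : Measurable fun a => vecMulVec (f a) (g a) :=
  (continuous_fst.matrix_vecMulVec continuous_snd).measurable.comp (hf.prodMk hg)

@[fun_prop]
lemma measurable_dotProduct [Fintype n] {f g : α → n → ℝ} (hf : Measurable f)
    (hg : Measurable g) : Measurable fun a => f a ⬝ᵥ g a :=
  (continuous_fst.dotProduct continuous_snd).measurable.comp (hf.prodMk hg)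

@[fun_prop]
lemma measurable_matrix_trace [Fintype n] : Measurable (trace : Matrix n n ℝ → ℝ) :=
  (continuous_id.matrix_trace).measurable

lemma isClosed_setOf_nonneg_matrix [Finite n] : IsClosed {M : Matrix n n ℝ | 0 ≤ M} := by
  cases nonempty_fintype n
  have h : {M : Matrix n n ℝ | 0 ≤ M} =
      {M | Mᵀ = M} ∩ ⋂ v : n → ℝ, {M | 0 ≤ v ⬝ᵥ (M *ᵥ v)} := by
    ext M
    simp [nonneg_iff_posSemidef, posSemidef_iff_dotProduct_mulVec, isHermitian_iff_isSymm, IsSymm]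
  rw [h]
  exact (isClosed_eq (by fun_prop) continuous_id).inter
    (isClosed_iInter fun v => isClosed_le continuous_const (by fun_prop))

@[fun_prop]
lemma measurable_matrix_det [Fintype n] [DecidableEq n] : Measurable (det : Matrix n n ℝ → ℝ) :=
  (continuous_id.matrix_det).measurable

@[fun_prop]
lemma measurable_matrix_inv [Fintype n] [DecidableEq n] :
    Measurable (fun M : Matrix n n ℝ => M⁻¹) := by
  simp only [inv_def, Ring.inverse_eq_inv']
  exact measurable_matrix_det.inv.smul (continuous_id.matrix_adjugate).measurable

lemma measurableSet_posDef [Finite n] : MeasurableSet {M : Matrix n n ℝ | M.PosDef} := by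
  cases nonempty_fintype n
  classical
  have h : {M : Matrix n n ℝ | M.PosDef} = {M | 0 ≤ M} ∩ {M | M.det ≠ 0} := by
    ext M
    exact ⟨fun h => ⟨h.posSemidef.nonneg, h.det_pos.ne'⟩,
      fun h => (nonneg_iff_posSemidef.1 h.1).posDef_iff_det_ne_zero.2 h.2⟩
  rw [h]
  exact isClosed_setOf_nonneg_matrix.measurableSet.inter
    (measurable_matrix_det (measurableSet_singleton 0).compl)

open scoped Classical Matrix.Norms.L2Operator NNReal in
lemma continuousOn_matrix_sqrt [Fintype n] :
    ContinuousOn (CFC.sqrt : Matrix n n ℝ → Matrix n n ℝ) {M | 0 ≤ M} :=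
  ContinuousOn.cfcₙ_nnreal_of_mem_nhdsSet (s := Set.univ) NNReal.sqrt Filter.univ_mem
    continuousOn_id (fun _ h => h) (by fun_prop) (by simp)

open Classical in
@[fun_prop]
lemma measurable_matrix_sqrt [Fintype n] :
    Measurable (CFC.sqrt : Matrix n n ℝ → Matrix n n ℝ) := by
  have h : (CFC.sqrt : Matrix n n ℝ → Matrix n n ℝ) =
      {M | 0 ≤ M}.piecewise CFC.sqrt fun _ => 0 := by
    ext1 M
    by_cases hM : 0 ≤ M
    · simp [Set.piecewise, hM]
    · simp [Set.piecewise, hM, CFC.sqrt_of_not_nonneg hM]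
  rw [h]
  exact continuousOn_matrix_sqrt.measurable_piecewise continuousOn_const
    isClosed_setOf_nonneg_matrix.measurableSet

end Measurability

/-! ### Coordinates on symmetric matrices -/

section SymmetricCoordinates

variable {k : ℕ}

/-- The coordinates of a matrix on and above the diagonal, inverse to `symMatrix` on symmetric
matrices. -/
def upperPart (M : Matrix (Fin k) (Fin k) ℝ) : UpperIdx k → ℝ :=
  fun ij => M ij.1.1 ij.1.2

lemma upperPart_symMatrix (s : UpperIdx k → ℝ) : upperPart (symMatrix s) = s :=
  funext fun ij => dif_pos ij.2

lemma isSymm_symMatrix (s : UpperIdx k → ℝ) : (symMatrix s).IsSymm := by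
  ext i j
  rcases lt_trichotomy i j with h | rfl | h
  · simp [symMatrix, h.le, not_le.mpr h]
  · simp [symMatrix]
  · simp [symMatrix, h.le, not_le.mpr h]

lemma symMatrix_upperPart {M : Matrix (Fin k) (Fin k) ℝ} (hM : M.IsSymm) :
    symMatrix (upperPart M) = M := by
  ext i j
  by_cases h : i ≤ j
  · simp [upperPart, symMatrix, h]
  · simpa [upperPart, symMatrix, h] using hM.apply i j

lemma symMatrix_injective : Function.Injective (symMatrix (k := k)) :=
  Function.LeftInverse.injective upperPart_symMatrix

lemma symMatrix_add (s t : UpperIdx k → ℝ) :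
    symMatrix (s + t) = symMatrix s + symMatrix t := by
  ext i j
  by_cases h : i ≤ j <;> simp [symMatrix, h]

lemma symMatrix_smul (c : ℝ) (s : UpperIdx k → ℝ) : symMatrix (c • s) = c • symMatrix s := by
  ext i j
  by_cases h : i ≤ j <;> simp [symMatrix, h]

@[fun_prop]
lemma measurable_symMatrix : Measurable (symMatrix (k := k)) := by
  refine Continuous.measurable (continuous_matrix fun i j => ?_)
  by_cases h : i ≤ j <;> simp only [symMatrix, of_apply, h, dite_true, dite_false] <;> fun_prop

/-- The congruence `Σ ↦ B Σ Bᵀ` on symmetric matrices, in the coordinates on and above the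
diagonal. -/
def congrLin (B : Matrix (Fin k) (Fin k) ℝ) : (UpperIdx k → ℝ) →ₗ[ℝ] (UpperIdx k → ℝ) where
  toFun s := upperPart (B * symMatrix s * Bᵀ)
  map_add' s t := by
    rw [symMatrix_add, Matrix.mul_add, Matrix.add_mul]; rfl
  map_smul' c s := by
    rw [symMatrix_smul, Matrix.mul_smul, Matrix.smul_mul]; rfl

lemma symMatrix_congrLin (B : Matrix (Fin k) (Fin k) ℝ) (s : UpperIdx k → ℝ) :
    symMatrix (congrLin B s) = B * symMatrix s * Bᵀ :=
  symMatrix_upperPart (M := B * symMatrix s * Bᵀ) (by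
    simp only [IsSymm, transpose_mul, transpose_transpose, (isSymm_symMatrix s).eq,
      Matrix.mul_assoc])

lemma congrLin_mul (B C : Matrix (Fin k) (Fin k) ℝ) :
    congrLin (B * C) = congrLin B ∘ₗ congrLin C :=
  LinearMap.ext fun s => symMatrix_injective <| by
    simp only [LinearMap.comp_apply, symMatrix_congrLin, transpose_mul, Matrix.mul_assoc]

lemma congrLin_one : congrLin (1 : Matrix (Fin k) (Fin k) ℝ) = LinearMap.id :=
  LinearMap.ext fun s => symMatrix_injective <| by simp [symMatrix_congrLin]

lemma det_congrLin_mul (B C : Matrix (Fin k) (Fin k) ℝ) :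
    LinearMap.det (congrLin (B * C)) =
      LinearMap.det (congrLin B) * LinearMap.det (congrLin C) := by
  rw [congrLin_mul, LinearMap.det_comp]

lemma prod_upperIdx {α : Type*} [CommMonoid α] (f : Fin k → Fin k → α) :
    ∏ ij : UpperIdx k, f ij.1.1 ij.1.2 = ∏ i, ∏ j, if i ≤ j then f i j else 1 := by
  rw [← Finset.prod_product', Finset.univ_product_univ, ← Finset.prod_filter]
  exact (Finset.prod_subtype _ (by simp) fun ij : Fin k × Fin k => f ij.1 ij.2).symm

lemma prod_upperIdx_mul {α : Type*} [CommMonoid α] (d : Fin k → α) :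
    ∏ ij : UpperIdx k, d ij.1.1 * d ij.1.2 = (∏ i, d i) ^ (k + 1) := by
  have factor (i j : Fin k) : ((if i ≤ j then d i else 1) * if j ≤ i then d i else 1) =
      d i * if i = j then d i else 1 := by
    rcases lt_trichotomy i j with h | h | h
    · simp [h.le, h.ne, not_le.mpr h]
    · simp [h]
    · simp [h.le, h.ne', not_le.mpr h]
  calc ∏ ij : UpperIdx k, d ij.1.1 * d ij.1.2
      = (∏ i, ∏ j, if i ≤ j then d i else 1) * ∏ i, ∏ j, if j ≤ i then d i else 1 := by
        rw [Finset.prod_mul_distrib, prod_upperIdx fun i _ => d i, prod_upperIdx fun _ j => d j,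
          Finset.prod_comm (f := fun i j => if i ≤ j then d j else 1)]
    _ = ∏ i, ∏ j, d i * if i = j then d i else 1 := by
        simp only [← Finset.prod_mul_distrib, factor]
    _ = (∏ i, d i) ^ (k + 1) := by
        simp only [Finset.prod_mul_distrib, Finset.prod_ite_eq, Finset.mem_univ, if_true,
          Finset.prod_const, Finset.card_univ, Fintype.card_fin, Finset.prod_pow, pow_succ]

lemma det_congrLin_diagonal (d : Fin k → ℝ) :
    LinearMap.det (congrLin (diagonal d)) = (diagonal d).det ^ (k + 1) := by
  have h : congrLin (diagonal d) =
      Matrix.toLin' (diagonal fun ij : UpperIdx k => d ij.1.1 * d ij.1.2) := by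
    refine LinearMap.ext fun s => funext fun ⟨⟨i, j⟩, (hij : i ≤ j)⟩ => ?_
    simp only [congrLin, upperPart, symMatrix, LinearMap.coe_mk, AddHom.coe_mk,
      diagonal_transpose, mul_diagonal, diagonal_mul, of_apply, hij, dite_true, toLin'_apply,
      mulVec_diagonal]
    ring
  rw [h, LinearMap.det_toLin', det_diagonal, det_diagonal, prod_upperIdx_mul]

lemma diagonal_mul_transvection {i j : Fin k} (hij : i ≠ j) (c : ℝ) :
    diagonal (Function.update 1 i 2) * transvection i j c =
      transvection i j (2 * c) * diagonal (Function.update 1 i 2) := by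
  have hl : diagonal (Function.update 1 i 2) * single i j c = single i j (2 * c) := by
    ext a b
    simp only [diagonal_mul, single_apply]
    aesop
  have hr : single i j (2 * c) * diagonal (Function.update 1 i 2) = single i j (2 * c) := by
    ext a b
    by_cases hb : b = j
    · simp [hb, hij.symm]
    · simp [Ne.symm hb]
  simp only [transvection, Matrix.mul_add, Matrix.add_mul, Matrix.mul_one, Matrix.one_mul, hl, hr]

-- A transvection is conjugate to its own square, so its Jacobian `J ≠ 0` satisfies `J = J ^ 2`.
lemma det_congrLin_transvection {i j : Fin k} (hij : i ≠ j) (c : ℝ) :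
    LinearMap.det (congrLin (transvection i j c)) = 1 := by
  set D : Matrix (Fin k) (Fin k) ℝ := diagonal (Function.update 1 i 2)
  have hD : LinearMap.det (congrLin D) ≠ 0 := by
    rw [det_congrLin_diagonal, det_diagonal, Finset.prod_update_of_mem (Finset.mem_univ i)]
    simp
  have hne : LinearMap.det (congrLin (transvection i j c)) ≠ 0 := by
    have hinv := congrArg (fun M => LinearMap.det (congrLin M))
      (transvection_mul_transvection_same i j hij c (-c))
    simp only [det_congrLin_mul, add_neg_cancel, transvection_zero, congrLin_one,
      LinearMap.det_id] at hinv
    exact left_ne_zero_of_mul_eq_one hinv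
  have hconj := congrArg (fun M => LinearMap.det (congrLin M)) (diagonal_mul_transvection hij c)
  simp only [two_mul, ← transvection_mul_transvection_same i j hij, det_congrLin_mul] at hconj
  have hsq : LinearMap.det (congrLin (transvection i j c)) =
      LinearMap.det (congrLin (transvection i j c)) *
        LinearMap.det (congrLin (transvection i j c)) :=
    mul_right_cancel₀ hD ((mul_comm _ _).trans hconj)
  exact (mul_eq_left₀ hne).1 hsq.symm

lemma det_congrLin {B : Matrix (Fin k) (Fin k) ℝ} (hB : B.det ≠ 0) :
    LinearMap.det (congrLin B) = B.det ^ (k + 1) := by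
  refine diagonal_transvection_induction_of_det_ne_zero
    (fun B => LinearMap.det (congrLin B) = B.det ^ (k + 1)) B hB
    (fun D _ => det_congrLin_diagonal D) (fun t => ?_) (fun A B _ _ hA hB => ?_)
  · rw [TransvectionStruct.toMatrix, det_congrLin_transvection t.hij,
      det_transvection_of_ne _ _ t.hij, one_pow]
  · rw [det_congrLin_mul, hA, hB, det_mul, mul_pow]

lemma measurable_congrLin (B : Matrix (Fin k) (Fin k) ℝ) : Measurable (congrLin B) :=
  (LinearMap.continuous_of_finiteDimensional (congrLin B)).measurable

lemma volume_eq_smul_map_congrLin {B : Matrix (Fin k) (Fin k) ℝ} (hB : B.det ≠ 0) :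
    (volume : Measure (UpperIdx k → ℝ)) =
      ENNReal.ofReal (|B.det| ^ (k + 1)) • volume.map (congrLin B) := by
  have hdet : LinearMap.det (congrLin B) ≠ 0 := det_congrLin hB ▸ pow_ne_zero _ hB
  rw [Real.map_linearMap_volume_pi_eq_smul_volume_pi hdet, smul_smul,
    ← ENNReal.ofReal_mul (by positivity), det_congrLin hB, abs_inv, abs_pow,
    mul_inv_cancel₀ (by positivity), ENNReal.ofReal_one, one_smul]

end SymmetricCoordinates

/-! ### Bordered matrices and Schur complements -/

section Bordered

variable {R : Type*} {k : ℕ}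

/-- The block matrix `[[a, rᵀ], [c, M]]`, indexed by `Fin (k + 1)` so that matrices can be treated
by induction on their size. -/
def bordered (a : R) (r c : Fin k → R) (M : Matrix (Fin k) (Fin k) R) :
    Matrix (Fin (k + 1)) (Fin (k + 1)) R :=
  Matrix.of (Fin.cons (Fin.cons a r : Fin (k + 1) → R)
    (fun i => (Fin.cons (c i) (M i) : Fin (k + 1) → R)) : Fin (k + 1) → Fin (k + 1) → R)

section Entries

variable (a : R) (r c : Fin k → R) (M : Matrix (Fin k) (Fin k) R)

@[simp] lemma bordered_zero_zero : bordered a r c M 0 0 = a := rfl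

@[simp] lemma bordered_zero_succ (j : Fin k) : bordered a r c M 0 j.succ = r j := rfl

@[simp] lemma bordered_succ_zero (i : Fin k) : bordered a r c M i.succ 0 = c i := rfl

@[simp] lemma bordered_succ_succ (i j : Fin k) : bordered a r c M i.succ j.succ = M i j := rfl

lemma bordered_transpose : (bordered a r c M)ᵀ = bordered a c r Mᵀ := by
  ext i j
  cases i using Fin.cases <;> cases j using Fin.cases <;> rfl

lemma trace_bordered [AddCommMonoid R] : (bordered a r c M).trace = a + M.trace := by
  simp [trace, Fin.sum_univ_succ]

lemma isSymm_bordered (hM : M.IsSymm) : (bordered a r r M).IsSymm :=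
  (bordered_transpose a r r M).trans (by rw [hM.eq])

end Entries

variable [CommRing R] {M : Matrix (Fin k) (Fin k) R}

lemma bordered_one : bordered (1 : R) 0 0 (1 : Matrix (Fin k) (Fin k) R) = 1 := by
  ext i j
  cases i using Fin.cases <;> cases j using Fin.cases <;>
    simp [one_apply, Fin.succ_ne_zero, (Fin.succ_ne_zero _).symm]

lemma bordered_mul_bordered (a b : R) (r c r' c' : Fin k → R)
    (M N : Matrix (Fin k) (Fin k) R) :
    bordered a r c M * bordered b r' c' N =
      bordered (a * b + r ⬝ᵥ c') (a • r' + r ᵥ* N) (b • c + M *ᵥ c') (vecMulVec c r' + M * N) := by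
  ext i j
  cases i using Fin.cases <;> cases j using Fin.cases <;>
    simp [mul_apply, Fin.sum_univ_succ, dotProduct, vecMul, mulVec, vecMulVec_apply, mul_comm]

lemma det_bordered_zero_left (a : R) (r : Fin k → R) (M : Matrix (Fin k) (Fin k) R) :
    (bordered a r 0 M).det = a * M.det := by
  have hsub : (bordered a r 0 M).submatrix Fin.succ Fin.succ = M := rfl
  simp [det_succ_column_zero, Fin.sum_univ_succ, hsub]

/-- The symmetric matrix with lower right block `M`, Schur complement `a` of that block, and first
column `M g` below the diagonal. -/
def schurBordered (a : R) (g : Fin k → R) (M : Matrix (Fin k) (Fin k) R) :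
    Matrix (Fin (k + 1)) (Fin (k + 1)) R :=
  bordered (a + g ⬝ᵥ (M *ᵥ g)) (M *ᵥ g) (M *ᵥ g) M

lemma schurBordered_eq_mul_mul_transpose (a : R) (g : Fin k → R) (hM : M.IsSymm) :
    schurBordered a g M =
      bordered 1 g 0 1 * bordered a 0 0 M * (bordered 1 g 0 1)ᵀ := by
  have hg : g ᵥ* M = M *ᵥ g := by rw [← mulVec_transpose, hM.eq]
  simp only [schurBordered, bordered_transpose, bordered_mul_bordered, hg]
  simp [dotProduct_comm]

lemma det_schurBordered (a : R) (g : Fin k → R) (hM : M.IsSymm) :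
    (schurBordered a g M).det = a * M.det := by
  rw [schurBordered_eq_mul_mul_transpose a g hM, det_mul, det_mul, det_transpose,
    det_bordered_zero_left, det_bordered_zero_left, det_one, mul_one, one_mul, mul_one]

end Bordered

section Schur

variable {k : ℕ} {M : Matrix (Fin k) (Fin k) ℝ}

lemma inv_schurBordered (g : Fin k → ℝ) (hM : M.IsSymm) (hdet : IsUnit M.det) {a : ℝ}
    (ha : a ≠ 0) :
    (schurBordered a g M)⁻¹ =
      bordered a⁻¹ (-(a⁻¹ • g)) (-(a⁻¹ • g)) (M⁻¹ + a⁻¹ • vecMulVec g g) := by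
  have hg : (M *ᵥ g) ᵥ* M⁻¹ = g := by
    rw [← vecMul_transpose, hM.eq, vecMul_vecMul, mul_nonsing_inv _ hdet, vecMul_one]
  refine inv_eq_right_inv ?_
  rw [schurBordered, bordered_mul_bordered, ← bordered_one]
  congr 1
  · simp only [dotProduct_neg, dotProduct_smul, dotProduct_comm (M *ᵥ g) g, smul_eq_mul]
    field_simp
    ring
  · rw [vecMul_add, hg, vecMul_smul, vecMul_vecMulVec, dotProduct_comm (M *ᵥ g) g]
    ext j
    simp only [Pi.add_apply, Pi.smul_apply, Pi.neg_apply, smul_eq_mul, Pi.zero_apply]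
    field_simp
    ring
  · rw [mulVec_neg, mulVec_smul, add_neg_cancel]
  · rw [Matrix.mul_add, mul_nonsing_inv _ hdet, Matrix.mul_smul, mul_vecMulVec, vecMulVec_neg,
      vecMulVec_smul]
    abel

lemma posDef_bordered_zero {a : ℝ} (ha : 0 < a) (hM : M.PosDef) : (bordered a 0 0 M).PosDef := by
  refine .of_dotProduct_mulVec_pos
    (isHermitian_iff_isSymm.2 (isSymm_bordered _ _ _ (isHermitian_iff_isSymm.1 hM.1)))
    fun v hv => ?_
  have hform : star v ⬝ᵥ (bordered a 0 0 M *ᵥ v) =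
      a * v 0 ^ 2 + Fin.tail v ⬝ᵥ (M *ᵥ Fin.tail v) := by
    simp [dotProduct, mulVec, Fin.sum_univ_succ, Fin.tail]
    ring
  have hnonneg : 0 ≤ Fin.tail v ⬝ᵥ (M *ᵥ Fin.tail v) :=
    hM.posSemidef.dotProduct_mulVec_nonneg (Fin.tail v)
  rw [hform]
  by_cases h0 : v 0 = 0
  · have htail : Fin.tail v ≠ 0 := fun h =>
      hv (funext fun i => by cases i using Fin.cases with
        | zero => exact h0
        | succ i => exact congrFun h i)
    have hpos : 0 < Fin.tail v ⬝ᵥ (M *ᵥ Fin.tail v) := hM.dotProduct_mulVec_pos htail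
    positivity
  · positivity

lemma posDef_schurBordered_iff (hM : M.PosDef) (g : Fin k → ℝ) {a : ℝ} :
    (schurBordered a g M).PosDef ↔ 0 < a := by
  have hsymm : M.IsSymm := isHermitian_iff_isSymm.1 hM.1
  constructor
  · intro h
    have hdet := h.det_pos
    rw [det_schurBordered a g hsymm] at hdet
    exact pos_of_mul_pos_left hdet hM.det_pos.le
  · intro ha
    have hU : IsUnit (bordered 1 g 0 (1 : Matrix (Fin k) (Fin k) ℝ)) := by
      rw [isUnit_iff_isUnit_det, det_bordered_zero_left, det_one, mul_one]
      exact isUnit_one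
    rw [schurBordered_eq_mul_mul_transpose a g hsymm]
    exact hU.posDef_star_right_conjugate_iff.2 (posDef_bordered_zero ha hM)

lemma posDef_of_posDef_bordered {a : ℝ} {r c : Fin k → ℝ} (h : (bordered a r c M).PosDef) :
    M.PosDef :=
  h.submatrix (Fin.succ_injective k)

end Schur

section BorderCoordinates

variable {k : ℕ}

/-- The coordinates on and above the diagonal of the symmetric matrix with first row `(a, gᵀ)` and
lower right block `symMatrix t`. -/
def borderCoord (a : ℝ) (g : Fin k → ℝ) (t : UpperIdx k → ℝ) : UpperIdx (k + 1) → ℝ :=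
  upperPart (bordered a g g (symMatrix t))

lemma symMatrix_borderCoord (a : ℝ) (g : Fin k → ℝ) (t : UpperIdx k → ℝ) :
    symMatrix (borderCoord a g t) = bordered a g g (symMatrix t) :=
  symMatrix_upperPart (isSymm_bordered _ _ _ (isSymm_symMatrix t))

lemma bijective_upperIdx_succ (k : ℕ) :
    Function.Bijective (Sum.elim (fun j => ⟨(0, j), Fin.zero_le j⟩)
      (fun ij => ⟨(ij.1.1.succ, ij.1.2.succ), Fin.succ_le_succ_iff.2 ij.2⟩) :
      Fin (k + 1) ⊕ UpperIdx k → UpperIdx (k + 1)) := by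
  constructor
  · rintro (j | ⟨⟨i, j⟩, h⟩) (j' | ⟨⟨i', j'⟩, h'⟩) <;> simp [Fin.succ_ne_zero, eq_comm]
  · rintro ⟨⟨i, j⟩, (hij : i ≤ j)⟩
    cases i using Fin.cases with
    | zero => exact ⟨.inl j, rfl⟩
    | succ i =>
      cases j using Fin.cases with
      | zero => exact absurd (Fin.le_zero_iff.1 hij) (Fin.succ_ne_zero i)
      | succ j => exact ⟨.inr ⟨(i, j), Fin.succ_le_succ_iff.1 hij⟩, rfl⟩

/-- The positions on and above the diagonal of a matrix of size `k + 1`, split into the first row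
and the positions of its lower right block. -/
def upperIdxEquiv (k : ℕ) : Fin (k + 1) ⊕ UpperIdx k ≃ UpperIdx (k + 1) :=
  Equiv.ofBijective _ (bijective_upperIdx_succ k)

lemma measurePreserving_borderCoord :
    MeasurePreserving fun x : (ℝ × (Fin k → ℝ)) × (UpperIdx k → ℝ) =>
      borderCoord x.1.1 x.1.2 x.2 := by
  have hrow := (volume_preserving_piFinSuccAbove (fun _ : Fin (k + 1) => ℝ) 0).symm
  have hsum := volume_measurePreserving_sumPiEquivProdPi_symm
    (fun _ : Fin (k + 1) ⊕ UpperIdx k => ℝ)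
  have hidx := volume_measurePreserving_piCongrLeft (fun _ => ℝ) (upperIdxEquiv k)
  have hcomp := hidx.comp (hsum.comp (hrow.prod (MeasurePreserving.id volume)))
  refine (congrArg (MeasurePreserving · volume volume) (funext fun ⟨⟨a, g⟩, t⟩ => ?_)).mpr hcomp
  ext ij
  obtain ⟨y, rfl⟩ := (upperIdxEquiv k).surjective ij
  simp only [Function.comp_apply, MeasurableEquiv.coe_piCongrLeft]
  erw [Equiv.piCongrLeft_apply_apply]
  rcases y with j | ij
  · cases j using Fin.cases <;> rfl
  · exact congrFun (upperPart_symMatrix t) ij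

lemma lintegral_borderCoord {F : (UpperIdx (k + 1) → ℝ) → ℝ≥0∞} (hF : Measurable F) :
    ∫⁻ s, F s = ∫⁻ t : UpperIdx k → ℝ, ∫⁻ g : Fin k → ℝ, ∫⁻ a : ℝ, F (borderCoord a g t) := by
  have hG := hF.fun_comp (measurePreserving_borderCoord (k := k)).measurable
  rw [← measurePreserving_borderCoord.lintegral_comp hF, Measure.volume_eq_prod,
    lintegral_prod_symm _ hG.aemeasurable]
  refine lintegral_congr fun t => ?_
  rw [Measure.volume_eq_prod,
    lintegral_prod_symm _ (hG.fun_comp measurable_prodMk_right).aemeasurable]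

end BorderCoordinates

/-! ### Changes of variables -/

section ChangeOfVariables

variable {k : ℕ}

lemma lintegral_comp_mulVec {M : Matrix (Fin k) (Fin k) ℝ} (hM : M.det ≠ 0)
    {F : (Fin k → ℝ) → ℝ≥0∞} (hF : Measurable F) :
    ∫⁻ v, F v = ENNReal.ofReal |M.det| * ∫⁻ g, F (M *ᵥ g) := by
  have hmap : volume.map (M *ᵥ ·) = ENNReal.ofReal |M.det⁻¹| • volume :=
    Real.map_matrix_volume_pi_eq_smul_volume_pi hM
  rw [← lintegral_map (g := (M *ᵥ ·)) hF (by fun_prop), hmap, lintegral_smul_measure, smul_eq_mul,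
    ← mul_assoc, ← ENNReal.ofReal_mul (by positivity), abs_inv, mul_inv_cancel₀ (by positivity),
    ENNReal.ofReal_one, one_mul]

lemma lintegral_comp_smul_pi {c : ℝ} (hc : c ≠ 0) {F : (Fin k → ℝ) → ℝ≥0∞} (hF : Measurable F) :
    ∫⁻ v, F v = ENNReal.ofReal (|c| ^ k) * ∫⁻ g, F (c • g) := by
  have hdet : (c • (1 : Matrix (Fin k) (Fin k) ℝ)).det = c ^ k := by simp
  simpa only [hdet, abs_pow, smul_mulVec, one_mulVec] using
    lintegral_comp_mulVec (M := c • 1) (hdet ▸ pow_ne_zero k hc) hF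

lemma lintegral_Ioi_inv (F : ℝ → ℝ≥0∞) :
    ∫⁻ a in Set.Ioi 0, F a = ∫⁻ w in Set.Ioi 0, ENNReal.ofReal (w ^ (-2 : ℝ)) * F w⁻¹ := by
  have himage : Inv.inv '' Set.Ioi (0 : ℝ) = Set.Ioi 0 := by
    ext y
    simp
  have h := lintegral_image_eq_lintegral_abs_deriv_mul (f := Inv.inv) measurableSet_Ioi
    (fun w (hw : 0 < w) => (hasDerivAt_inv hw.ne').hasDerivWithinAt) inv_injective.injOn F
  rw [himage] at h
  refine h.trans (setLIntegral_congr_fun measurableSet_Ioi fun w (hw : 0 < w) => ?_)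
  simp only [abs_neg, abs_inv, abs_pow, abs_of_pos hw, Real.rpow_neg hw.le, Real.rpow_two]

lemma lintegral_posDef_succ {F : Matrix (Fin (k + 1)) (Fin (k + 1)) ℝ → ℝ≥0∞} (hF : Measurable F)
    (hF₀ : ∀ M, ¬ M.PosDef → F M = 0) :
    ∫⁻ s, F (symMatrix s) = ∫⁻ t : UpperIdx k → ℝ in {t | (symMatrix t).PosDef},
      ENNReal.ofReal (symMatrix t).det *
        ∫⁻ g, ∫⁻ a in Set.Ioi 0, F (schurBordered a g (symMatrix t)) := by
  have hS : MeasurableSet {t : UpperIdx k → ℝ | (symMatrix t).PosDef} :=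
    measurable_symMatrix measurableSet_posDef
  rw [lintegral_borderCoord (by fun_prop), ← lintegral_indicator hS]
  refine lintegral_congr fun t => ?_
  by_cases hM : (symMatrix t).PosDef
  · have hmeas : Measurable fun x : ℝ × (Fin k → ℝ) => F (symMatrix (borderCoord x.1 x.2 t)) :=
      (hF.comp measurable_symMatrix).comp
        ((measurePreserving_borderCoord (k := k)).measurable.comp measurable_prodMk_right)
    rw [Set.indicator_of_mem (show t ∈ {t | (symMatrix t).PosDef} from hM),
      lintegral_comp_mulVec hM.det_pos.ne' hmeas.lintegral_prod_left, abs_of_pos hM.det_pos]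
    congr 1
    refine lintegral_congr fun g => ?_
    rw [← lintegral_add_right_eq_self _ (g ⬝ᵥ (symMatrix t *ᵥ g)),
      ← lintegral_indicator measurableSet_Ioi]
    refine lintegral_congr fun a => ?_
    rw [symMatrix_borderCoord]
    by_cases ha : 0 < a
    · rw [Set.indicator_of_mem (show a ∈ Set.Ioi 0 from ha)]
      rfl
    · rw [Set.indicator_of_notMem (show a ∉ Set.Ioi 0 from ha)]
      exact hF₀ _ (mt (posDef_schurBordered_iff hM g).1 ha)
  · rw [Set.indicator_of_notMem (show t ∉ {t | (symMatrix t).PosDef} from hM)]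
    simp only [symMatrix_borderCoord, hF₀ _ (mt posDef_of_posDef_bordered hM), lintegral_zero]

@[fun_prop]
lemma measurable_finCons {α : Type*} [MeasurableSpace α] {f : α → ℝ} {g : α → Fin k → ℝ}
    (hf : Measurable f) (hg : Measurable g) :
    Measurable fun a => (Fin.cons (f a) (g a) : Fin (k + 1) → ℝ) :=
  ((continuous_fst.finCons (A := fun _ => ℝ) continuous_snd).measurable.comp (hf.prodMk hg) :)

end ChangeOfVariables

/-! ### The inverse Wishart measure -/

section InverseWishart

variable {k : ℕ}

open Classical in
/-- The unnormalized density `|M|^{-d/2} exp(-tr(M⁻¹ A)/2)` of the inverse Wishart distribution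
`IW_k(d, A)`, extended by `0` to all matrices. -/
def invWishartWeight (d : ℝ) (A M : Matrix (Fin k) (Fin k) ℝ) : ℝ≥0∞ :=
  if M.PosDef then ENNReal.ofReal (M.det ^ (-d / 2) * Real.exp (-(M⁻¹ * A).trace / 2)) else 0

lemma invWishartWeight_of_posDef {M : Matrix (Fin k) (Fin k) ℝ} (hM : M.PosDef) (d : ℝ)
    (A : Matrix (Fin k) (Fin k) ℝ) : invWishartWeight d A M =
      ENNReal.ofReal (M.det ^ (-d / 2) * Real.exp (-(M⁻¹ * A).trace / 2)) :=
  if_pos hM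

lemma invWishartWeight_of_not_posDef {M : Matrix (Fin k) (Fin k) ℝ} (hM : ¬ M.PosDef) (d : ℝ)
    (A : Matrix (Fin k) (Fin k) ℝ) : invWishartWeight d A M = 0 :=
  if_neg hM

lemma measurable_invWishartWeight (d : ℝ) :
    Measurable fun x : Matrix (Fin k) (Fin k) ℝ × Matrix (Fin k) (Fin k) ℝ =>
      invWishartWeight d x.1 x.2 :=
  Measurable.ite (measurable_snd measurableSet_posDef) (by fun_prop) measurable_const

@[fun_prop]
lemma measurable_invWishartWeight_comp {α : Type*} [MeasurableSpace α] (d : ℝ)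
    {A M : α → Matrix (Fin k) (Fin k) ℝ} (hA : Measurable A) (hM : Measurable M) :
    Measurable fun a => invWishartWeight d (A a) (M a) :=
  (measurable_invWishartWeight d).comp (hA.prodMk hM)

/-- The unnormalized inverse Wishart distribution `IW_k(d, A)`, in the coordinates on and above the
diagonal. -/
def invWishartMeasure (d : ℝ) (A : Matrix (Fin k) (Fin k) ℝ) : Measure (UpperIdx k → ℝ) :=
  volume.withDensity fun s => invWishartWeight d A (symMatrix s)

lemma lintegral_invWishartMeasure (d : ℝ) (A : Matrix (Fin k) (Fin k) ℝ)
    {F : (UpperIdx k → ℝ) → ℝ≥0∞} (hF : Measurable F) :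
    ∫⁻ s, F s ∂invWishartMeasure d A = ∫⁻ s, invWishartWeight d A (symMatrix s) * F s :=
  lintegral_withDensity_eq_lintegral_mul _ (by fun_prop) hF

lemma invWishartMeasure_univ (d : ℝ) (A : Matrix (Fin k) (Fin k) ℝ) :
    invWishartMeasure d A Set.univ = ∫⁻ s, invWishartWeight d A (symMatrix s) := by
  rw [invWishartMeasure, withDensity_apply _ .univ, setLIntegral_univ]

lemma ofReal_det_mul_invWishartWeight {M : Matrix (Fin k) (Fin k) ℝ} (hM : M.PosDef) (d : ℝ)
    (A : Matrix (Fin k) (Fin k) ℝ) :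
    ENNReal.ofReal M.det * invWishartWeight d A M = invWishartWeight (d - 2) A M := by
  have hpow : M.det ^ (-(d - 2) / 2) = M.det * M.det ^ (-d / 2) := by
    rw [show -(d - 2) / 2 = 1 + -d / 2 by ring, Real.rpow_add hM.det_pos, Real.rpow_one]
  rw [invWishartWeight_of_posDef hM, invWishartWeight_of_posDef hM,
    ← ENNReal.ofReal_mul hM.det_pos.le, hpow, mul_assoc]

lemma invWishartWeight_schurBordered {M : Matrix (Fin k) (Fin k) ℝ} (hM : M.PosDef) (d : ℝ) {a : ℝ}
    (ha : 0 < a) (g : Fin k → ℝ) :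
    invWishartWeight d 1 (schurBordered a g M) =
      ENNReal.ofReal (a ^ (-d / 2) * Real.exp (-(a⁻¹ * (1 + g ⬝ᵥ g)) / 2)) *
        invWishartWeight d 1 M := by
  have hsymm : M.IsSymm := isHermitian_iff_isSymm.1 hM.1
  have htrace : (schurBordered a g M)⁻¹.trace = a⁻¹ * (1 + g ⬝ᵥ g) + M⁻¹.trace := by
    rw [inv_schurBordered g hsymm hM.det_pos.ne'.isUnit ha.ne', trace_bordered, trace_add,
      trace_smul, trace_vecMulVec, smul_eq_mul]
    ring
  rw [invWishartWeight_of_posDef ((posDef_schurBordered_iff hM g).2 ha),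
    invWishartWeight_of_posDef hM, ← ENNReal.ofReal_mul (by positivity), mul_one, mul_one, htrace,
    det_schurBordered a g hsymm, Real.mul_rpow ha.le hM.det_pos.le, neg_add, add_div, Real.exp_add]
  ring_nf

lemma inv_schurBordered_mulVec_single {M : Matrix (Fin k) (Fin k) ℝ} (hM : M.PosDef) {a : ℝ}
    (ha : a ≠ 0) (g : Fin k → ℝ) :
    (schurBordered a g M)⁻¹ *ᵥ Pi.single 0 1 = Fin.cons a⁻¹ (-(a⁻¹ • g)) := by
  rw [inv_schurBordered g (isHermitian_iff_isSymm.1 hM.1) hM.det_pos.ne'.isUnit ha,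
    mulVec_single_one]
  ext i
  cases i using Fin.cases <;> rfl

lemma lintegral_invWishartWeight_one_inv_mulVec_single (d : ℝ) {F : (Fin (k + 1) → ℝ) → ℝ≥0∞}
    (hF : Measurable F) :
    ∫⁻ s, invWishartWeight d 1 (symMatrix s) * F ((symMatrix s)⁻¹ *ᵥ Pi.single 0 1) =
      invWishartMeasure (d - 2) (1 : Matrix (Fin k) (Fin k) ℝ) Set.univ *
        ∫⁻ g : Fin k → ℝ, ∫⁻ a in Set.Ioi 0,
          ENNReal.ofReal (a ^ (-d / 2) * Real.exp (-(a⁻¹ * (1 + g ⬝ᵥ g)) / 2)) *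
            F (Fin.cons a⁻¹ (-(a⁻¹ • g))) := by
  have hS : MeasurableSet {t : UpperIdx k → ℝ | (symMatrix t).PosDef} :=
    measurable_symMatrix measurableSet_posDef
  rw [lintegral_posDef_succ (F := fun M => invWishartWeight d 1 M * F (M⁻¹ *ᵥ Pi.single 0 1))
      (by fun_prop) (fun M hM => by rw [invWishartWeight_of_not_posDef hM, zero_mul]),
    invWishartMeasure_univ, ← lintegral_mul_const _ (by fun_prop), ← lintegral_indicator hS]
  refine lintegral_congr fun t => ?_
  by_cases hM : (symMatrix t).PosDef
  · have hne : invWishartWeight d 1 (symMatrix t) ≠ ∞ := by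
      rw [invWishartWeight_of_posDef hM]
      exact ENNReal.ofReal_ne_top
    rw [Set.indicator_of_mem (show t ∈ {t | (symMatrix t).PosDef} from hM),
      ← ofReal_det_mul_invWishartWeight hM, mul_assoc, ← lintegral_const_mul' _ _ hne]
    congr 1
    refine lintegral_congr fun g => ?_
    rw [← lintegral_const_mul' _ _ hne]
    refine setLIntegral_congr_fun measurableSet_Ioi fun a (ha : 0 < a) => ?_
    simp only [invWishartWeight_schurBordered hM d ha, inv_schurBordered_mulVec_single hM ha.ne']
    ring
  · rw [Set.indicator_of_notMem (show t ∉ {t | (symMatrix t).PosDef} from hM),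
      invWishartWeight_of_not_posDef hM, zero_mul]

end InverseWishart

/-! ### Chi-square and Gaussian variables -/

section ChiSquareGaussian

variable {k : ℕ}

lemma isProbabilityMeasure_chiSq {ν : ℝ} (hν : 0 < ν) : IsProbabilityMeasure (chiSq ν) :=
  isProbabilityMeasure_gammaMeasure (by positivity) (by norm_num)

lemma lintegral_chiSq {ν : ℝ} (hν : 0 < ν) {G : ℝ → ℝ≥0∞} (hG : Measurable G) :
    ∫⁻ w in Set.Ioi 0, ENNReal.ofReal (w ^ (ν / 2 - 1) * Real.exp (-w / 2)) * G w =
      ENNReal.ofReal (Real.Gamma (ν / 2) / (1 / 2) ^ (ν / 2)) * ∫⁻ w, G w ∂chiSq ν := by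
  have : 0 < Real.Gamma (ν / 2) := Real.Gamma_pos_of_pos (by positivity)
  have hpdf : Measurable (gammaPDF (ν / 2) (1 / 2)) :=
    (measurable_gammaPDFReal (ν / 2) (1 / 2)).ennreal_ofReal
  have hne : ∀ᵐ w : ℝ, w ≠ 0 := by simp [ae_iff]
  rw [chiSq, gammaMeasure, lintegral_withDensity_eq_lintegral_mul _ hpdf hG,
    ← lintegral_const_mul' _ _ ENNReal.ofReal_ne_top, ← lintegral_indicator measurableSet_Ioi]
  refine lintegral_congr_ae ?_
  filter_upwards [hne] with w hw
  rcases lt_or_gt_of_ne hw with h | h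
  · rw [Set.indicator_of_notMem (by simpa using h.le), Pi.mul_apply, gammaPDF_of_neg h, zero_mul,
      mul_zero]
  · rw [Set.indicator_of_mem (Set.mem_Ioi.2 h), Pi.mul_apply, gammaPDF_of_nonneg h.le, ← mul_assoc,
      ← ENNReal.ofReal_mul (by positivity)]
    congr 2
    rw [show -(1 / 2 * w) = -w / 2 by ring]
    field_simp

lemma norm_sq_eq_dotProduct {ι : Type*} [Fintype ι] (v : EuclideanSpace ℝ ι) :
    ‖v‖ ^ 2 = v.ofLp ⬝ᵥ v.ofLp := by
  rw [EuclideanSpace.real_norm_sq_eq]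
  simp only [dotProduct, sq]

variable {V : Type*} [NormedAddCommGroup V] [InnerProductSpace ℝ V] [FiniteDimensional ℝ V]
  [MeasurableSpace V] [BorelSpace V]

lemma integrable_exp_neg_norm_sq : Integrable fun v : V => Real.exp (-‖v‖ ^ 2 / 2) := by
  refine (GaussianFourier.integrable_cexp_neg_mul_sq_norm_add (V := V) (b := 1 / 2)
    (by norm_num) 0 0).re.congr (.of_forall fun v => ?_)
  have hexp : -(1 / 2 : ℂ) * (‖v‖ : ℂ) ^ 2 + 0 * ((inner ℝ 0 v : ℝ) : ℂ) =
      ((-‖v‖ ^ 2 / 2 : ℝ) : ℂ) := by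
    push_cast
    ring
  simp only [hexp, ← Complex.ofReal_exp]
  rfl

lemma withDensity_exp_neg_norm_sq_eq_smul_stdGaussian :
    (volume : Measure V).withDensity (fun v => ENNReal.ofReal (Real.exp (-‖v‖ ^ 2 / 2))) =
      ENNReal.ofReal ((2 * Real.pi) ^ ((Module.finrank ℝ V : ℝ) / 2)) • stdGaussian V := by
  have := isFiniteMeasure_withDensity_ofReal (integrable_exp_neg_norm_sq (V := V)).2
  have := Measure.smul_finite (stdGaussian V)
    (ENNReal.ofReal_ne_top (r := (2 * Real.pi) ^ ((Module.finrank ℝ V : ℝ) / 2)))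
  have hfourier (v t : V) :
      (ENNReal.ofReal (Real.exp (-‖v‖ ^ 2 / 2))).toReal •
        Complex.exp ((inner ℝ v t : ℝ) * Complex.I) =
      Complex.exp (-(1 / 2 : ℂ) * (‖v‖ : ℂ) ^ 2 + Complex.I * ((inner ℝ t v : ℝ) : ℂ)) := by
    rw [ENNReal.toReal_ofReal (by positivity), Complex.exp_add, real_inner_comm, Complex.real_smul,
      Complex.ofReal_exp]
    congr 2
    · push_cast
      ring
    · ring
  refine Measure.ext_of_charFun (funext fun t => ?_)
  rw [charFun_apply, charFun_apply, integral_smul_measure,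
    ← charFun_apply (μ := stdGaussian V), charFun_stdGaussian,
    integral_withDensity_eq_integral_toReal_smul (by fun_prop) (by simp)]
  simp only [hfourier]
  rw [GaussianFourier.integral_cexp_neg_mul_sq_norm_add (by norm_num),
    ENNReal.toReal_ofReal (by positivity), Complex.real_smul, Complex.ofReal_cpow (by positivity)]
  congr 2
  · push_cast
    ring
  · push_cast
    ring
  · rw [Complex.I_sq]
    ring

lemma lintegral_stdGaussian {G : (Fin k → ℝ) → ℝ≥0∞} (hG : Measurable G) :
    ∫⁻ z, ENNReal.ofReal (Real.exp (-(z ⬝ᵥ z) / 2)) * G z =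
      ENNReal.ofReal ((2 * Real.pi) ^ ((k : ℝ) / 2)) *
        ∫⁻ y, G y.ofLp ∂stdGaussian (EuclideanSpace ℝ (Fin k)) := by
  have hgauss := withDensity_exp_neg_norm_sq_eq_smul_stdGaussian (V := EuclideanSpace ℝ (Fin k))
  rw [finrank_euclideanSpace_fin] at hgauss
  rw [← (PiLp.volume_preserving_ofLp (Fin k)).lintegral_comp (by fun_prop), ← smul_eq_mul,
    ← lintegral_smul_measure, ← hgauss,
    lintegral_withDensity_eq_lintegral_mul _ (by fun_prop) (by fun_prop)]
  simp only [Pi.mul_apply, norm_sq_eq_dotProduct]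

lemma lintegral_exp_neg_mul_dotProduct {w : ℝ} (hw : 0 < w) {G : (Fin k → ℝ) → ℝ≥0∞}
    (hG : Measurable G) :
    ∫⁻ g, ENNReal.ofReal (Real.exp (-(w * (g ⬝ᵥ g)) / 2)) * G (-(w • g)) =
      ENNReal.ofReal (w ^ (-(k : ℝ) / 2)) *
        ∫⁻ z, ENNReal.ofReal (Real.exp (-(z ⬝ᵥ z) / 2)) * G (√w • z) := by
  have hs : 0 < √w := Real.sqrt_pos.2 hw
  have hss : w = √w * √w := (Real.mul_self_sqrt hw.le).symm
  have hconst : |-(√w)⁻¹| ^ k = w ^ (-(k : ℝ) / 2) := by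
    rw [abs_neg, abs_inv, abs_of_pos hs, Real.sqrt_eq_rpow, ← Real.rpow_neg hw.le,
      ← Real.rpow_natCast, ← Real.rpow_mul hw.le]
    ring_nf
  have hquad (z : Fin k → ℝ) : w * ((-(√w)⁻¹ • z) ⬝ᵥ (-(√w)⁻¹ • z)) = z ⬝ᵥ z := by
    simp only [smul_dotProduct, dotProduct_smul, smul_eq_mul]
    nth_rw 1 [hss]
    field_simp
  have harg (z : Fin k → ℝ) : -(w • (-(√w)⁻¹ • z)) = √w • z := by
    rw [smul_smul, ← neg_smul]
    congr 1
    nth_rw 1 [hss]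
    field_simp
  rw [lintegral_comp_smul_pi (c := -(√w)⁻¹) (neg_ne_zero.2 (inv_ne_zero hs.ne')) (by fun_prop),
    hconst]
  simp only [hquad, harg]

-- Substitute `a = w⁻¹` and `g = -z / √w`.
lemma lintegral_schurComplement (d : ℝ) {F : (Fin (k + 1) → ℝ) → ℝ≥0∞} (hF : Measurable F) :
    ∫⁻ g : Fin k → ℝ, ∫⁻ a in Set.Ioi 0,
        ENNReal.ofReal (a ^ (-d / 2) * Real.exp (-(a⁻¹ * (1 + g ⬝ᵥ g)) / 2)) *
          F (Fin.cons a⁻¹ (-(a⁻¹ • g))) =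
      ∫⁻ w in Set.Ioi 0, ENNReal.ofReal (w ^ ((d - k - 2) / 2 - 1) * Real.exp (-w / 2)) *
        ∫⁻ z : Fin k → ℝ, ENNReal.ofReal (Real.exp (-(z ⬝ᵥ z) / 2)) *
          F (Fin.cons w (√w • z)) := by
  have hinv (g : Fin k → ℝ) : ∫⁻ a in Set.Ioi 0,
        ENNReal.ofReal (a ^ (-d / 2) * Real.exp (-(a⁻¹ * (1 + g ⬝ᵥ g)) / 2)) *
          F (Fin.cons a⁻¹ (-(a⁻¹ • g))) =
      ∫⁻ w in Set.Ioi 0, ENNReal.ofReal (w ^ (d / 2 - 2) * Real.exp (-w / 2)) *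
        (ENNReal.ofReal (Real.exp (-(w * (g ⬝ᵥ g)) / 2)) * F (Fin.cons w (-(w • g)))) := by
    rw [lintegral_Ioi_inv]
    refine setLIntegral_congr_fun measurableSet_Ioi fun w (hw : 0 < w) => ?_
    have hpow : w ^ (d / 2 - 2) = w ^ (-2 : ℝ) * w⁻¹ ^ (-d / 2) := by
      rw [Real.inv_rpow hw.le, ← Real.rpow_neg hw.le, ← Real.rpow_add hw]
      ring_nf
    have hexp : Real.exp (-(w * (1 + g ⬝ᵥ g)) / 2) =
        Real.exp (-w / 2) * Real.exp (-(w * (g ⬝ᵥ g)) / 2) := by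
      rw [← Real.exp_add]
      ring_nf
    simp only [inv_inv, hpow, hexp, ← mul_assoc]
    rw [← ENNReal.ofReal_mul (by positivity), ← ENNReal.ofReal_mul (by positivity)]
    ring_nf
  simp only [hinv]
  rw [lintegral_lintegral_swap (by fun_prop)]
  refine setLIntegral_congr_fun measurableSet_Ioi fun w (hw : 0 < w) => ?_
  have hpow : w ^ ((d - k - 2) / 2 - 1) = w ^ (d / 2 - 2) * w ^ (-(k : ℝ) / 2) := by
    rw [← Real.rpow_add hw]
    ring_nf
  simp only [lintegral_const_mul' _ _ ENNReal.ofReal_ne_top]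
  rw [lintegral_exp_neg_mul_dotProduct hw (G := fun g => F (Fin.cons w g)) (by fun_prop),
    ← mul_assoc, ← ENNReal.ofReal_mul (by positivity), hpow, mul_right_comm]

end ChiSquareGaussian

/-! ### Square roots and factorizations -/

section Factorization

variable {k : ℕ} {ι : Type*} [Fintype ι] [DecidableEq ι]

lemma transpose_sqrt (S : Matrix ι ι ℝ) : (CFC.sqrt S)ᵀ = CFC.sqrt S :=
  isHermitian_iff_isSymm.1 (nonneg_iff_posSemidef.1 (CFC.sqrt_nonneg S)).1

lemma sqrt_mul_sqrt {S : Matrix ι ι ℝ} (hS : S.PosSemidef) :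
    CFC.sqrt S * CFC.sqrt S = S :=
  CFC.sqrt_mul_sqrt_self S hS.nonneg

lemma isUnit_det_sqrt {S : Matrix ι ι ℝ} (hS : S.PosDef) : IsUnit (CFC.sqrt S).det := by
  refine isUnit_of_mul_isUnit_left (y := (CFC.sqrt S).det) ?_
  rw [← det_mul, sqrt_mul_sqrt hS.posSemidef]
  exact hS.det_pos.ne'.isUnit

lemma exists_eq_smul_norm_one [NeZero k] (v : Fin k → ℝ) :
    ∃ (e : EuclideanSpace ℝ (Fin k)) (c : ℝ), ‖e‖ = 1 ∧ v = c • e.ofLp := by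
  by_cases hv : v = 0
  · exact ⟨EuclideanSpace.single 0 1, 0, by simp, by simp [hv]⟩
  · set y : EuclideanSpace ℝ (Fin k) := WithLp.toLp 2 v
    have hy : ‖y‖ ≠ 0 := by simpa [y] using hv
    refine ⟨‖y‖⁻¹ • y, ‖y‖, ?_, ?_⟩
    · rw [norm_smul, norm_inv, norm_norm, inv_mul_cancel₀ hy]
    · rw [WithLp.ofLp_smul, smul_smul, mul_inv_cancel₀ hy, one_smul]

lemma exists_orthogonal_mulVec_single [NeZero k] (v : Fin k → ℝ) :
    ∃ (O : Matrix (Fin k) (Fin k) ℝ) (c : ℝ), O * Oᵀ = 1 ∧ v = c • (O *ᵥ Pi.single 0 1) := by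
  obtain ⟨e, c, he, hv⟩ := exists_eq_smul_norm_one v
  have horth : Orthonormal ℝ (({0} : Set (Fin k)).domRestrict fun _ => e) :=
    ⟨fun _ => he, fun i j hij => absurd (Subsingleton.elim i j) hij⟩
  obtain ⟨b, hb⟩ := horth.exists_orthonormalBasis_extension_of_card_eq (by simp)
  refine ⟨Matrix.of fun i j => b j i, c, mul_eq_one_comm.1 ?_, ?_⟩
  · ext i j
    rw [one_apply, ← orthonormal_iff_ite.1 b.orthonormal i j,
      EuclideanSpace.inner_eq_star_dotProduct, star_trivial, dotProduct_comm]
    rfl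
  · rw [hv, mulVec_single_one, ← hb 0 rfl]
    rfl

lemma exists_mul_transpose_eq_and_eq_smul_mulVec_single [NeZero k] {A : Matrix (Fin k) (Fin k) ℝ}
    (hA : A.PosDef) (v : Fin k → ℝ) :
    ∃ (B : Matrix (Fin k) (Fin k) ℝ) (c : ℝ), B.det ≠ 0 ∧ B * Bᵀ = A ∧
      v = c • (B *ᵥ Pi.single 0 1) := by
  obtain ⟨O, c, hO, hv⟩ := exists_orthogonal_mulVec_single ((CFC.sqrt A)⁻¹ *ᵥ v)
  have hBB : CFC.sqrt A * O * (CFC.sqrt A * O)ᵀ = A := by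
    rw [transpose_mul, transpose_sqrt, Matrix.mul_assoc, ← Matrix.mul_assoc O, hO, Matrix.one_mul,
      sqrt_mul_sqrt hA.posSemidef]
  refine ⟨CFC.sqrt A * O, c, fun hdet => hA.det_pos.ne' ?_, hBB, ?_⟩
  · rw [← hBB, det_mul, hdet, zero_mul]
  · rw [← mulVec_mulVec, ← mulVec_smul, ← hv, mulVec_mulVec,
      mul_nonsing_inv _ (isUnit_det_sqrt hA), one_mulVec]

end Factorization

/-! ### Linear images of Gaussian vectors -/

section GaussianImage

variable {m m' p : ℕ}

lemma charFun_map_mulVec_stdGaussian (A : Matrix (Fin p) (Fin m) ℝ)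
    (t : EuclideanSpace ℝ (Fin p)) :
    charFun ((stdGaussian (EuclideanSpace ℝ (Fin m))).map
        fun y => WithLp.toLp 2 (A *ᵥ y.ofLp)) t =
      Complex.exp (-((t.ofLp ⬝ᵥ ((A * Aᵀ) *ᵥ t.ofLp) : ℝ) : ℂ) / 2) := by
  have hinner (y : EuclideanSpace ℝ (Fin m)) :
      inner ℝ (WithLp.toLp 2 (A *ᵥ y.ofLp) : EuclideanSpace ℝ (Fin p)) t =
        inner ℝ y (WithLp.toLp 2 (Aᵀ *ᵥ t.ofLp)) := by
    simp only [EuclideanSpace.inner_eq_star_dotProduct, star_trivial]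
    rw [mulVec_transpose, ← dotProduct_mulVec]
  rw [charFun_apply, integral_map (by fun_prop) (by fun_prop)]
  simp only [hinner]
  rw [← charFun_apply, charFun_stdGaussian, ← Complex.ofReal_pow, norm_sq_eq_dotProduct,
    ← mulVec_mulVec, dotProduct_mulVec t.ofLp, ← mulVec_transpose]

lemma map_mulVec_stdGaussian_eq_of_mul_transpose_eq {A : Matrix (Fin p) (Fin m) ℝ}
    {A' : Matrix (Fin p) (Fin m') ℝ} (h : A * Aᵀ = A' * A'ᵀ) :
    (stdGaussian (EuclideanSpace ℝ (Fin m))).map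
        (fun y => (WithLp.toLp 2 (A *ᵥ y.ofLp) : EuclideanSpace ℝ (Fin p))) =
      (stdGaussian (EuclideanSpace ℝ (Fin m'))).map fun y => WithLp.toLp 2 (A' *ᵥ y.ofLp) := by
  have {m : ℕ} (A : Matrix (Fin p) (Fin m) ℝ) :
      IsProbabilityMeasure ((stdGaussian (EuclideanSpace ℝ (Fin m))).map
        fun y => (WithLp.toLp 2 (A *ᵥ y.ofLp) : EuclideanSpace ℝ (Fin p))) :=
    Measure.isProbabilityMeasure_map (by fun_prop)
  refine Measure.ext_of_charFun (funext fun t => ?_)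
  rw [charFun_map_mulVec_stdGaussian, charFun_map_mulVec_stdGaussian, h]

lemma lintegral_mulVec_stdGaussian (A : Matrix (Fin p) (Fin m) ℝ) {G : (Fin p → ℝ) → ℝ≥0∞}
    (hG : Measurable G) :
    ∫⁻ y, G (A *ᵥ y.ofLp) ∂stdGaussian (EuclideanSpace ℝ (Fin m)) =
      ∫⁻ z, G (CFC.sqrt (A * Aᵀ) *ᵥ z.ofLp) ∂stdGaussian (EuclideanSpace ℝ (Fin p)) := by
  have hG' : Measurable fun y : EuclideanSpace ℝ (Fin p) => G y.ofLp := by fun_prop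
  have hsqrt : A * Aᵀ = CFC.sqrt (A * Aᵀ) * (CFC.sqrt (A * Aᵀ))ᵀ := by
    rw [transpose_sqrt, sqrt_mul_sqrt (S := A * Aᵀ) (posSemidef_self_mul_conjTranspose A)]
  have h := congrArg (fun ρ => ∫⁻ y, G y.ofLp ∂ρ)
    (map_mulVec_stdGaussian_eq_of_mul_transpose_eq hsqrt)
  simpa only [lintegral_map hG' (by fun_prop : Measurable fun y : EuclideanSpace ℝ (Fin m) =>
      (WithLp.toLp 2 (A *ᵥ y.ofLp) : EuclideanSpace ℝ (Fin p))),
    lintegral_map hG' (by fun_prop : Measurable fun z : EuclideanSpace ℝ (Fin p) =>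
      (WithLp.toLp 2 (CFC.sqrt (A * Aᵀ) *ᵥ z.ofLp) : EuclideanSpace ℝ (Fin p)))] using h

end GaussianImage

/-! ### Inverse Wishart matrices applied to a vector -/

section InverseWishartLaw

variable {k : ℕ}

/-- The factor by which the total mass of the inverse Wishart measure with identity scale grows when
a row and a column are added to a `k × k` matrix; `ν` is the degrees of freedom of the Schur
complement's chi-square distribution. -/
def borderMass (k : ℕ) (ν : ℝ) : ℝ≥0∞ :=
  ENNReal.ofReal (Real.Gamma (ν / 2) / (1 / 2) ^ (ν / 2)) *
    ENNReal.ofReal ((2 * Real.pi) ^ ((k : ℝ) / 2))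

lemma borderMass_ne_zero (k : ℕ) {ν : ℝ} (hν : 0 < ν) : borderMass k ν ≠ 0 := by
  have : 0 < Real.Gamma (ν / 2) := Real.Gamma_pos_of_pos (by positivity)
  refine mul_ne_zero ?_ ?_ <;> rw [ENNReal.ofReal_ne_zero_iff] <;> positivity

lemma borderMass_ne_top (k : ℕ) (ν : ℝ) : borderMass k ν ≠ ∞ :=
  ENNReal.mul_ne_top ENNReal.ofReal_ne_top ENNReal.ofReal_ne_top

lemma lintegral_inv_mulVec_single_eq_borderMass_mul {d : ℝ} (hd : (k : ℝ) + 2 < d)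
    {F : (Fin (k + 1) → ℝ) → ℝ≥0∞} (hF : Measurable F) :
    ∫⁻ s, F ((symMatrix s)⁻¹ *ᵥ Pi.single 0 1) ∂invWishartMeasure d 1 =
      invWishartMeasure (d - 2) (1 : Matrix (Fin k) (Fin k) ℝ) Set.univ *
        borderMass k (d - k - 2) *
          ∫⁻ w, ∫⁻ z, F (Fin.cons w (√w • z.ofLp)) ∂stdGaussian (EuclideanSpace ℝ (Fin k))
            ∂chiSq (d - k - 2) := by
  have hgauss (w : ℝ) := lintegral_stdGaussian (G := fun z => F (Fin.cons w (√w • z)))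
    (by fun_prop)
  rw [lintegral_invWishartMeasure _ _ (by fun_prop),
    lintegral_invWishartWeight_one_inv_mulVec_single d hF, lintegral_schurComplement d hF]
  simp only [hgauss]
  rw [lintegral_chiSq (by linarith) (by fun_prop), lintegral_const_mul' _ _ ENNReal.ofReal_ne_top,
    borderMass]
  ring

lemma invWishartMeasure_one_univ_succ {d : ℝ} (hd : (k : ℝ) + 2 < d) :
    invWishartMeasure d (1 : Matrix (Fin (k + 1)) (Fin (k + 1)) ℝ) Set.univ =
      invWishartMeasure (d - 2) (1 : Matrix (Fin k) (Fin k) ℝ) Set.univ *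
        borderMass k (d - k - 2) := by
  have := isProbabilityMeasure_chiSq (ν := d - k - 2) (by linarith)
  simpa only [lintegral_one, measure_univ, mul_one] using
    lintegral_inv_mulVec_single_eq_borderMass_mul hd (F := fun _ => 1) measurable_const

lemma lintegral_inv_mulVec_single_invWishartMeasure_one {d : ℝ} (hd : (k : ℝ) + 2 < d)
    {F : (Fin (k + 1) → ℝ) → ℝ≥0∞} (hF : Measurable F) :
    ∫⁻ s, F ((symMatrix s)⁻¹ *ᵥ Pi.single 0 1) ∂invWishartMeasure d 1 =
      invWishartMeasure d (1 : Matrix (Fin (k + 1)) (Fin (k + 1)) ℝ) Set.univ *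
        ∫⁻ w, ∫⁻ z, F (Fin.cons w (√w • z.ofLp)) ∂stdGaussian (EuclideanSpace ℝ (Fin k))
          ∂chiSq (d - k - 2) := by
  rw [lintegral_inv_mulVec_single_eq_borderMass_mul hd hF, invWishartMeasure_one_univ_succ hd]

lemma invWishartMeasure_zero_univ (d : ℝ) (A : Matrix (Fin 0) (Fin 0) ℝ) :
    invWishartMeasure d A Set.univ = 1 := by
  have hweight (t : UpperIdx 0 → ℝ) : invWishartWeight d A (symMatrix t) = 1 := by
    rw [Subsingleton.elim (symMatrix t) 1, invWishartWeight_of_posDef PosDef.one]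
    simp [trace]
  rw [invWishartMeasure_univ]
  simp only [hweight, lintegral_one, volume_pi]
  rw [Measure.pi_of_empty, measure_univ]

lemma invWishartMeasure_one_univ_ne {d : ℝ} (hd : 2 * (k : ℝ) < d) :
    invWishartMeasure d (1 : Matrix (Fin k) (Fin k) ℝ) Set.univ ≠ 0 ∧
      invWishartMeasure d (1 : Matrix (Fin k) (Fin k) ℝ) Set.univ ≠ ∞ := by
  induction k generalizing d with
  | zero => simp [invWishartMeasure_zero_univ]
  | succ k ih =>
    push_cast at hd
    have : (0 : ℝ) ≤ k := k.cast_nonneg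
    rw [invWishartMeasure_one_univ_succ (by linarith)]
    obtain ⟨hzero, htop⟩ := ih (d := d - 2) (by linarith)
    exact ⟨mul_ne_zero hzero (borderMass_ne_zero k (by linarith)),
      ENNReal.mul_ne_top htop (borderMass_ne_top k _)⟩

lemma invWishartWeight_mul_mul_transpose {B : Matrix (Fin k) (Fin k) ℝ} (hB : B.det ≠ 0) (d : ℝ)
    (M : Matrix (Fin k) (Fin k) ℝ) :
    invWishartWeight d (B * Bᵀ) (B * M * Bᵀ) =
      ENNReal.ofReal (|B.det| ^ (-d)) * invWishartWeight d 1 M := by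
  have hiff : (B * M * Bᵀ).PosDef ↔ M.PosDef :=
    ((isUnit_iff_isUnit_det B).2 hB.isUnit).posDef_star_right_conjugate_iff
  by_cases hM : M.PosDef
  · have hdet : (B * M * Bᵀ).det ^ (-d / 2) = |B.det| ^ (-d) * M.det ^ (-d / 2) := by
      rw [det_mul, det_mul, det_transpose, mul_right_comm, ← abs_mul_abs_self B.det,
        Real.mul_rpow (by positivity) hM.det_pos.le,
        Real.mul_rpow (by positivity) (by positivity), ← Real.rpow_add (abs_pos.2 hB), add_halves]
    have htrace : ((B * M * Bᵀ)⁻¹ * (B * Bᵀ)).trace = M⁻¹.trace := by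
      rw [Matrix.mul_inv_rev, Matrix.mul_inv_rev, Matrix.mul_assoc, Matrix.mul_assoc,
        nonsing_inv_mul_cancel_left _ _ hB.isUnit, trace_mul_comm, Matrix.mul_assoc,
        mul_nonsing_inv _ (by simpa using hB.isUnit), mul_one]
    rw [invWishartWeight_of_posDef hM, invWishartWeight_of_posDef (hiff.2 hM), hdet, htrace,
      ← ENNReal.ofReal_mul (by positivity), mul_one, mul_assoc]
  · rw [invWishartWeight_of_not_posDef hM, invWishartWeight_of_not_posDef (mt hiff.1 hM), mul_zero]

lemma lintegral_invWishartMeasure_mul_transpose {B : Matrix (Fin k) (Fin k) ℝ} (hB : B.det ≠ 0)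
    (d : ℝ) {F : (UpperIdx k → ℝ) → ℝ≥0∞} (hF : Measurable F) :
    ∫⁻ s, F s ∂invWishartMeasure d (B * Bᵀ) =
      ENNReal.ofReal (|B.det| ^ (k + 1 - d)) *
        ∫⁻ s, F (congrLin B s) ∂invWishartMeasure d 1 := by
  have hB' : 0 < |B.det| := abs_pos.2 hB
  have hpow : |B.det| ^ ((k : ℝ) + 1 - d) = |B.det| ^ (k + 1) * |B.det| ^ (-d) := by
    rw [sub_eq_add_neg, Real.rpow_add hB', ← Real.rpow_natCast]
    push_cast
    rfl
  have hmeas := measurable_congrLin B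
  rw [lintegral_invWishartMeasure _ _ hF, lintegral_invWishartMeasure _ _ (by fun_prop)]
  conv_lhs => rw [volume_eq_smul_map_congrLin hB]
  rw [lintegral_smul_measure, lintegral_map (by fun_prop) hmeas]
  simp only [symMatrix_congrLin, invWishartWeight_mul_mul_transpose hB]
  simp only [mul_assoc]
  rw [lintegral_const_mul' _ _ ENNReal.ofReal_ne_top, smul_eq_mul, ← mul_assoc,
    ← ENNReal.ofReal_mul (by positivity), hpow]

lemma invWishartMeasure_mul_transpose_univ {B : Matrix (Fin k) (Fin k) ℝ} (hB : B.det ≠ 0)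
    (d : ℝ) : invWishartMeasure d (B * Bᵀ) Set.univ =
      ENNReal.ofReal (|B.det| ^ (k + 1 - d)) *
        invWishartMeasure d (1 : Matrix (Fin k) (Fin k) ℝ) Set.univ := by
  simpa only [lintegral_one] using
    lintegral_invWishartMeasure_mul_transpose hB d (F := fun _ => 1) measurable_const

lemma invWishartMeasure_univ_eq_det_rpow_mul {A : Matrix (Fin k) (Fin k) ℝ} (hA : A.PosDef)
    (d : ℝ) : invWishartMeasure d A Set.univ =
      ENNReal.ofReal (A.det ^ (-(d - k - 1) / 2)) *
        invWishartMeasure d (1 : Matrix (Fin k) (Fin k) ℝ) Set.univ := by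
  have hsqrt : CFC.sqrt A * (CFC.sqrt A)ᵀ = A := by
    rw [transpose_sqrt, sqrt_mul_sqrt hA.posSemidef]
  have hdet : (CFC.sqrt A).det ≠ 0 := (isUnit_det_sqrt hA).ne_zero
  have hpow : A.det ^ (-(d - k - 1) / 2) = |(CFC.sqrt A).det| ^ (k + 1 - d) := by
    rw [← sqrt_mul_sqrt hA.posSemidef, det_mul, ← abs_mul_abs_self, ← sq, ← Real.rpow_natCast,
      ← Real.rpow_mul (abs_nonneg _), sqrt_mul_sqrt hA.posSemidef]
    push_cast
    ring_nf
  rw [hpow, ← invWishartMeasure_mul_transpose_univ hdet, hsqrt]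

/-- The normal mean–variance mixture `w L ζ + √w (ε L Υ Lᵀ - L ζ ζᵀ Lᵀ)^{1/2} z`, the common shape
of the conditional law of `L Σ⁻¹ v` and of the representation of the portfolio weights. -/
def meanVarianceMixture {p : ℕ} (L : Matrix (Fin p) (Fin k) ℝ) (ε : ℝ) (ζ : Fin k → ℝ)
    (Υ : Matrix (Fin k) (Fin k) ℝ) (w : ℝ) (z : Fin p → ℝ) : Fin p → ℝ :=
  w • (L *ᵥ ζ) + √w • (CFC.sqrt (ε • (L * Υ * Lᵀ) - L * vecMulVec ζ ζ * Lᵀ) *ᵥ z)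

lemma mulVec_finCons {p : ℕ} (G : Matrix (Fin p) (Fin (k + 1)) ℝ) (w : ℝ) (y : Fin k → ℝ) :
    G *ᵥ Fin.cons w y = w • G.col 0 + G.submatrix id Fin.succ *ᵥ y := by
  ext i
  simp [mulVec, dotProduct, Fin.sum_univ_succ, mul_comm]

lemma submatrix_succ_mul_transpose {p : ℕ} (G : Matrix (Fin p) (Fin (k + 1)) ℝ) :
    G.submatrix id Fin.succ * (G.submatrix id Fin.succ)ᵀ =
      G * Gᵀ - vecMulVec (G.col 0) (G.col 0) := by
  ext i j
  simp [mul_apply, Fin.sum_univ_succ, vecMulVec_apply]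

lemma lintegral_mulVec_finCons_stdGaussian {p : ℕ} (G : Matrix (Fin p) (Fin (k + 1)) ℝ) (w : ℝ)
    {f : (Fin p → ℝ) → ℝ≥0∞} (hf : Measurable f) :
    ∫⁻ y, f (G *ᵥ Fin.cons w (√w • y.ofLp)) ∂stdGaussian (EuclideanSpace ℝ (Fin k)) =
      ∫⁻ z, f (w • G.col 0 + √w • (CFC.sqrt (G * Gᵀ - vecMulVec (G.col 0) (G.col 0)) *ᵥ z.ofLp))
        ∂stdGaussian (EuclideanSpace ℝ (Fin p)) := by
  simp only [mulVec_finCons, mulVec_smul, ← submatrix_succ_mul_transpose]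
  exact lintegral_mulVec_stdGaussian (G.submatrix id Fin.succ)
    (G := fun y => f (w • G.col 0 + √w • y)) (by fun_prop)

lemma exists_mul_transpose_eq_and_mulVec_inv_eq [NeZero k] {p : ℕ} {A : Matrix (Fin k) (Fin k) ℝ}
    (hA : A.PosDef) (L : Matrix (Fin p) (Fin k) ℝ) (v : Fin k → ℝ) :
    ∃ (B : Matrix (Fin k) (Fin k) ℝ) (G : Matrix (Fin p) (Fin k) ℝ), B.det ≠ 0 ∧ B * Bᵀ = A ∧
      G * Gᵀ = (v ⬝ᵥ (A⁻¹ *ᵥ v)) • (L * A⁻¹ * Lᵀ) ∧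
      ∀ M, L *ᵥ ((B * M * Bᵀ)⁻¹ *ᵥ v) = G *ᵥ (M⁻¹ *ᵥ Pi.single 0 1) := by
  obtain ⟨B, c, hB, hBA, hv⟩ := exists_mul_transpose_eq_and_eq_smul_mulVec_single hA v
  have hBv : B⁻¹ *ᵥ v = c • Pi.single 0 1 := by
    rw [hv, mulVec_smul, mulVec_mulVec, nonsing_inv_mul _ hB.isUnit, one_mulVec]
  have hinv : A⁻¹ = B⁻¹ᵀ * B⁻¹ := by rw [← hBA, Matrix.mul_inv_rev, transpose_nonsing_inv]
  have hε : v ⬝ᵥ (A⁻¹ *ᵥ v) = c * c := by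
    rw [hinv, ← mulVec_mulVec, dotProduct_mulVec, ← mulVec_transpose, transpose_transpose, hBv]
    simp
  refine ⟨B, c • (L * B⁻¹ᵀ), hB, hBA, ?_, fun M => ?_⟩
  · rw [hε, hinv]
    simp only [transpose_smul, transpose_mul, transpose_transpose, Matrix.smul_mul,
      Matrix.mul_smul, smul_smul, Matrix.mul_assoc]
  · rw [Matrix.mul_inv_rev, Matrix.mul_inv_rev, ← mulVec_mulVec, ← mulVec_mulVec, hBv, smul_mulVec,
      ← mulVec_mulVec, transpose_nonsing_inv]
    simp only [mulVec_smul]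

theorem lintegral_inv_mulVec_invWishartMeasure [NeZero k] {d : ℝ} (hd : 2 * (k : ℝ) < d)
    {p : ℕ} {A : Matrix (Fin k) (Fin k) ℝ} (hA : A.PosDef) (L : Matrix (Fin p) (Fin k) ℝ)
    (v : Fin k → ℝ) {f : (Fin p → ℝ) → ℝ≥0∞} (hf : Measurable f) :
    ∫⁻ s, f (L *ᵥ ((symMatrix s)⁻¹ *ᵥ v)) ∂invWishartMeasure d A =
      invWishartMeasure d A Set.univ *
        ∫⁻ w, ∫⁻ z, f (meanVarianceMixture L (v ⬝ᵥ (A⁻¹ *ᵥ v)) (A⁻¹ *ᵥ v) A⁻¹ w z.ofLp)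
          ∂stdGaussian (EuclideanSpace ℝ (Fin p)) ∂chiSq (d - k - 1) := by
  obtain ⟨k, rfl⟩ := Nat.exists_eq_add_one_of_ne_zero (NeZero.ne k)
  obtain ⟨B, G, hB, hBA, hcov, hG⟩ := exists_mul_transpose_eq_and_mulVec_inv_eq hA L v
  have hcol : G.col 0 = L *ᵥ (A⁻¹ *ᵥ v) := by
    rw [← mulVec_single_one, ← one_mulVec (Pi.single 0 1), ← inv_one, ← hG, mul_one, hBA]
  have hrank : L * vecMulVec (A⁻¹ *ᵥ v) (A⁻¹ *ᵥ v) * Lᵀ = vecMulVec (G.col 0) (G.col 0) := by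
    rw [mul_vecMulVec, vecMulVec_mul, vecMul_transpose, hcol]
  have hν : d - (k + 1 : ℕ) - 1 = d - k - 2 := by
    push_cast
    ring
  have hd' : (k : ℝ) + 2 < d := by
    push_cast at hd
    linarith [k.cast_nonneg (α := ℝ)]
  simp only [meanVarianceMixture, hrank, ← hcov, ← hcol, hν]
  simp only [← lintegral_mulVec_finCons_stdGaussian G _ hf]
  rw [← hBA, lintegral_invWishartMeasure_mul_transpose hB d (by fun_prop),
    invWishartMeasure_mul_transpose_univ hB, mul_assoc]
  simp only [symMatrix_congrLin, hG]
  rw [lintegral_inv_mulVec_single_invWishartMeasure_one hd' (F := fun y => f (G *ᵥ y))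
    (by fun_prop)]

end InverseWishartLaw

/-! ### Rank-one updates -/

section RankOneUpdate

lemma inv_add_smul_vecMulVec {n K : Type*} [Fintype n] [DecidableEq n] [Field K]
    {A : Matrix n n K} (hA : IsUnit A.det) {q : K} {v w : n → K}
    (h : 1 + q * (w ⬝ᵥ (A⁻¹ *ᵥ v)) ≠ 0) :
    (A + q • vecMulVec v w)⁻¹ =
      A⁻¹ - (q / (1 + q * (w ⬝ᵥ (A⁻¹ *ᵥ v)))) • vecMulVec (A⁻¹ *ᵥ v) (w ᵥ* A⁻¹) := by
  refine inv_eq_right_inv ?_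
  rw [Matrix.add_mul, Matrix.mul_sub, Matrix.mul_sub, mul_nonsing_inv _ hA, Matrix.mul_smul,
    Matrix.mul_smul, Matrix.smul_mul, Matrix.smul_mul, mul_vecMulVec, mulVec_mulVec,
    mul_nonsing_inv _ hA, one_mulVec, vecMulVec_mul, vecMulVec_mul_vecMulVec, vecMulVec_smul,
    smul_smul, smul_smul, ← sub_smul, sub_add, ← sub_smul]
  convert sub_zero (1 : Matrix n n K)
  convert zero_smul K _
  field_simp
  ring

lemma det_add_smul_vecMulVec {n K : Type*} [Fintype n] [DecidableEq n] [Field K]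
    {A : Matrix n n K} (hA : IsUnit A.det) (q : K) (v w : n → K) :
    (A + q • vecMulVec v w).det = A.det * (1 + q * (w ⬝ᵥ (A⁻¹ *ᵥ v))) := by
  rw [← smul_vecMulVec, vecMulVec_eq Unit, det_add_replicateCol_mul_replicateRow hA,
    Matrix.mul_assoc, ← replicateCol_mulVec, mulVec_smul]
  simp [replicateRow_mul_replicateCol_apply]

variable {k : ℕ}

lemma transpose_invSqrt (S : Matrix (Fin k) (Fin k) ℝ) : (invSqrt S)ᵀ = invSqrt S := by
  rw [invSqrt, transpose_nonsing_inv, transpose_sqrt]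

lemma invSqrt_mul_vecMulVec_mul_invSqrt (S : Matrix (Fin k) (Fin k) ℝ) (u : Fin k → ℝ) :
    invSqrt S * vecMulVec u u * invSqrt S = vecMulVec (invSqrt S *ᵥ u) (invSqrt S *ᵥ u) := by
  rw [mul_vecMulVec, vecMulVec_mul, ← mulVec_transpose, transpose_invSqrt]

lemma upsilonFun_eq_sub_smul_vecMulVec (S : Matrix (Fin k) (Fin k) ℝ) (q : ℝ) (u : Fin k → ℝ) :
    upsilonFun S q u =
      S⁻¹ - (q / (1 + q)) • vecMulVec (invSqrt S *ᵥ u) (invSqrt S *ᵥ u) := by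
  rw [upsilonFun, invSqrt_mul_vecMulVec_mul_invSqrt]

variable {S : Matrix (Fin k) (Fin k) ℝ}

lemma inv_mulVec_sqrt_mulVec (hS : S.PosDef) (u : Fin k → ℝ) :
    S⁻¹ *ᵥ (CFC.sqrt S *ᵥ u) = invSqrt S *ᵥ u := by
  nth_rw 1 [← sqrt_mul_sqrt hS.posSemidef]
  rw [Matrix.mul_inv_rev, mulVec_mulVec, Matrix.mul_assoc,
    nonsing_inv_mul _ (isUnit_det_sqrt hS), mul_one, invSqrt]

lemma sqrt_mulVec_vecMul_inv (hS : S.PosDef) (u : Fin k → ℝ) :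
    (CFC.sqrt S *ᵥ u) ᵥ* S⁻¹ = invSqrt S *ᵥ u := by
  rw [← mulVec_transpose, transpose_nonsing_inv, (isHermitian_iff_isSymm.1 hS.1).eq,
    inv_mulVec_sqrt_mulVec hS]

lemma sqrt_mulVec_dotProduct_invSqrt_mulVec (hS : S.PosDef) (u v : Fin k → ℝ) :
    (CFC.sqrt S *ᵥ u) ⬝ᵥ (invSqrt S *ᵥ v) = u ⬝ᵥ v := by
  rw [dotProduct_mulVec, ← mulVec_transpose, transpose_invSqrt, mulVec_mulVec, invSqrt,
    nonsing_inv_mul _ (isUnit_det_sqrt hS), one_mulVec]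

variable {q : ℝ} {u : Fin k → ℝ}

lemma smul_vecMulVec_sqrt_div_sqrt_smul {N : ℝ} (hN : 0 < N) (hq : 0 ≤ q) (v : Fin k → ℝ) :
    N • vecMulVec ((√q / √N) • v) ((√q / √N) • v) = q • vecMulVec v v := by
  rw [smul_vecMulVec, vecMulVec_smul, smul_smul, smul_smul, mul_assoc, div_mul_div_comm,
    Real.mul_self_sqrt hq, Real.mul_self_sqrt hN.le, mul_div_cancel₀ _ hN.ne']

lemma inv_add_smul_vecMulVec_sqrt (hS : S.PosDef) (hq : 0 ≤ q) (hu : u ⬝ᵥ u = 1) :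
    (S + q • vecMulVec (CFC.sqrt S *ᵥ u) (CFC.sqrt S *ᵥ u))⁻¹ = upsilonFun S q u := by
  have hquad : (CFC.sqrt S *ᵥ u) ⬝ᵥ (S⁻¹ *ᵥ (CFC.sqrt S *ᵥ u)) = 1 := by
    rw [inv_mulVec_sqrt_mulVec hS, sqrt_mulVec_dotProduct_invSqrt_mulVec hS, hu]
  rw [inv_add_smul_vecMulVec hS.det_pos.ne'.isUnit (by rw [hquad]; positivity), hquad, mul_one,
    sqrt_mulVec_vecMul_inv hS, inv_mulVec_sqrt_mulVec hS, upsilonFun_eq_sub_smul_vecMulVec]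

lemma det_add_smul_vecMulVec_sqrt (hS : S.PosDef) (q : ℝ) (hu : u ⬝ᵥ u = 1) :
    (S + q • vecMulVec (CFC.sqrt S *ᵥ u) (CFC.sqrt S *ᵥ u)).det = S.det * (1 + q) := by
  rw [det_add_smul_vecMulVec hS.det_pos.ne'.isUnit, inv_mulVec_sqrt_mulVec hS,
    sqrt_mulVec_dotProduct_invSqrt_mulVec hS, hu, mul_one]

lemma upsilonFun_mulVec_add (hS : S.PosDef) (N : ℝ) (hq : 0 ≤ q) (hu : u ⬝ᵥ u = 1)
    (b : Fin k → ℝ) :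
    upsilonFun S q u *ᵥ (b + (√q / √N) • (CFC.sqrt S *ᵥ u)) = zetaFun b S N q u := by
  simp only [upsilonFun_eq_sub_smul_vecMulVec, zetaFun, invSqrt_mul_vecMulVec_mul_invSqrt,
    sub_mulVec, smul_mulVec, mulVec_add, mulVec_smul, inv_mulVec_sqrt_mulVec hS, vecMulVec_mulVec,
    op_smul_eq_smul, dotProduct_comm _ (CFC.sqrt S *ᵥ u),
    sqrt_mulVec_dotProduct_invSqrt_mulVec hS, hu]
  match_scalars <;> field_simp
  ring

lemma dotProduct_zetaFun (hS : S.PosDef) {N : ℝ} (hN : 0 < N) (hq : 0 ≤ q) (hu : u ⬝ᵥ u = 1)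
    (b : Fin k → ℝ) :
    (b + (√q / √N) • (CFC.sqrt S *ᵥ u)) ⬝ᵥ zetaFun b S N q u = epsilonFun b S N q u := by
  have hcross : (CFC.sqrt S *ᵥ u) ⬝ᵥ (S⁻¹ *ᵥ b) = b ⬝ᵥ (invSqrt S *ᵥ u) := by
    rw [dotProduct_mulVec, sqrt_mulVec_vecMul_inv hS, dotProduct_comm]
  simp only [zetaFun, epsilonFun, invSqrt_mul_vecMulVec_mul_invSqrt, vecMulVec_mulVec,
    op_smul_eq_smul, dotProduct_add, dotProduct_sub, add_dotProduct, smul_dotProduct,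
    dotProduct_smul, smul_eq_mul, hcross, sqrt_mulVec_dotProduct_invSqrt_mulVec hS, hu,
    dotProduct_comm (invSqrt S *ᵥ u) b]
  have hsq : √q ^ 2 = q := Real.sq_sqrt hq
  have hsN : √N ^ 2 = N := Real.sq_sqrt hN.le
  have hN' : √N ≠ 0 := (Real.sqrt_pos.2 hN).ne'
  generalize √q = r at *
  generalize √N = ν at *
  subst hsq hsN
  field_simp
  ring

lemma meanVarianceMixture_rankOne_eq_representation {p : ℕ} (hS : S.PosDef) {N : ℝ} (hN : 0 < N)
    (hq : 0 ≤ q) (hu : u ⬝ᵥ u = 1) (C : ℝ) (L : Matrix (Fin p) (Fin k) ℝ) (b : Fin k → ℝ) (w : ℝ)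
    (z : Fin p → ℝ) {v : Fin k → ℝ} (hv : v = (√q / √N) • (CFC.sqrt S *ᵥ u)) :
    C • meanVarianceMixture L ((b + v) ⬝ᵥ ((S + N • vecMulVec v v)⁻¹ *ᵥ (b + v)))
        ((S + N • vecMulVec v v)⁻¹ *ᵥ (b + v)) (S + N • vecMulVec v v)⁻¹ w z =
      representation C L b S N w z q u := by
  rw [hv, smul_vecMulVec_sqrt_div_sqrt_smul hN hq, inv_add_smul_vecMulVec_sqrt hS hq hu,
    upsilonFun_mulVec_add hS N hq hu,
    dotProduct_zetaFun hS hN hq hu, meanVarianceMixture, representation, smul_add, smul_smul,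
    smul_smul]

@[fun_prop]
lemma measurable_representation {α : Type*} [MeasurableSpace α] {p : ℕ} (C : ℝ)
    (L : Matrix (Fin p) (Fin k) ℝ) (b : Fin k → ℝ) (S : Matrix (Fin k) (Fin k) ℝ) (N : ℝ)
    {η q : α → ℝ} {z : α → Fin p → ℝ} {u : α → Fin k → ℝ} (hη : Measurable η) (hz : Measurable z)
    (hq : Measurable q) (hu : Measurable u) :
    Measurable fun a => representation C L b S N (η a) (z a) (q a) (u a) := by
  unfold representation epsilonFun zetaFun upsilonFun
  fun_prop

end RankOneUpdate

/-! ### Polar coordinates and the F-distribution -/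

section PolarCoordinates

lemma lintegral_eq_lintegral_toSphere_lintegral_Ioi {E : Type*} [NormedAddCommGroup E]
    [NormedSpace ℝ E] [FiniteDimensional ℝ E] [Nontrivial E] [MeasurableSpace E] [BorelSpace E]
    (μ : Measure E) [μ.IsAddHaarMeasure] {F : E → ℝ≥0∞} (hF : Measurable F) :
    ∫⁻ y, F y ∂μ = ∫⁻ u : Metric.sphere (0 : E) 1, (∫⁻ r in Set.Ioi (0 : ℝ),
      ENNReal.ofReal (r ^ (Module.finrank ℝ E - 1)) * F (r • u.1)) ∂μ.toSphere := by
  let G : Metric.sphere (0 : E) 1 × Set.Ioi (0 : ℝ) → ℝ≥0∞ := fun x => F (x.2.1 • x.1.1)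
  have hG : Measurable G := by fun_prop
  have hpolar (y : ({0}ᶜ : Set E)) : F y = G (homeomorphUnitSphereProd E y) := by
    conv_lhs => rw [← (homeomorphUnitSphereProd E).symm_apply_apply y]
    rfl
  calc ∫⁻ y, F y ∂μ = ∫⁻ y : ({0}ᶜ : Set E), F y ∂(μ.comap Subtype.val) := by
        rw [lintegral_subtype_comap (measurableSet_singleton _).compl, restrict_compl_singleton]
    _ = ∫⁻ u, ∫⁻ r, G (u, r) ∂Measure.volumeIoiPow (Module.finrank ℝ E - 1) ∂μ.toSphere := by
        simp only [hpolar]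
        rw [μ.measurePreserving_homeomorphUnitSphereProd.lintegral_comp hG,
          lintegral_prod _ hG.aemeasurable]
    _ = _ := lintegral_congr fun u => by
        rw [Measure.volumeIoiPow, lintegral_withDensity_eq_lintegral_mul _ (by fun_prop)
          (by fun_prop)]
        exact lintegral_subtype_comap (μ := volume) measurableSet_Ioi
          fun r : ℝ => ENNReal.ofReal (r ^ (Module.finrank ℝ E - 1)) * F (r • u.1)

lemma lintegral_Ioi_rpow_mul_comp_sq {κ : ℝ} (hκ : 0 < κ) (a : ℝ) (G : ℝ → ℝ≥0∞) :
    ∫⁻ r in Set.Ioi 0, ENNReal.ofReal (r ^ (a - 1)) * G (r ^ 2) =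
      ∫⁻ y in Set.Ioi 0, ENNReal.ofReal (κ ^ (a / 2) / 2 * y ^ (a / 2 - 1)) * G (κ * y) := by
  have him : (fun y : ℝ => √(κ * y)) '' Set.Ioi 0 = Set.Ioi 0 := by
    ext r
    refine ⟨fun ⟨y, hy, hyr⟩ => hyr ▸ Real.sqrt_pos.2 (mul_pos hκ hy),
      fun hr => ⟨r ^ 2 / κ, div_pos (pow_pos hr 2) hκ, ?_⟩⟩
    simp only [mul_div_cancel₀ _ hκ.ne', Real.sqrt_sq (le_of_lt hr)]
  have hderiv (y : ℝ) (hy : y ∈ Set.Ioi 0) :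
      HasDerivWithinAt (fun y => √(κ * y)) (κ / (2 * √(κ * y))) (Set.Ioi 0) y := by
    simpa using
      (((hasDerivAt_id y).const_mul κ).sqrt (mul_pos hκ hy).ne').hasDerivWithinAt
  have hinj : Set.InjOn (fun y => √(κ * y)) (Set.Ioi 0) := fun x hx y hy h =>
    mul_left_cancel₀ hκ.ne' ((Real.sqrt_inj (mul_pos hκ hx).le (mul_pos hκ hy).le).1 h)
  conv_lhs => rw [← him]
  rw [lintegral_image_eq_lintegral_abs_deriv_mul measurableSet_Ioi hderiv hinj]
  refine setLIntegral_congr_fun measurableSet_Ioi fun y (hy : 0 < y) => ?_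
  have hκy : 0 < κ * y := mul_pos hκ hy
  have hpow : √(κ * y) ^ a = κ ^ (a / 2) * y ^ (a / 2) := by
    rw [Real.sqrt_eq_rpow, ← Real.rpow_mul hκy.le, one_div_mul_eq_div, Real.mul_rpow hκ.le hy.le]
  have hjac : κ / (2 * √(κ * y)) * √(κ * y) ^ (a - 1) = κ ^ (a / 2) / 2 * y ^ (a / 2 - 1) := by
    rw [Real.rpow_sub_one (Real.sqrt_pos.2 hκy).ne', Real.rpow_sub_one hy.ne', hpow]
    field_simp
    rw [Real.sq_sqrt hκy.le]
  rw [← mul_assoc, ← ENNReal.ofReal_mul (abs_nonneg _), abs_of_pos (by positivity), hjac,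
    Real.sq_sqrt hκy.le]

lemma lintegral_fisherF {a b : ℝ} (ha : 0 < a) (hb : 0 < b) {G : ℝ → ℝ≥0∞} (hG : Measurable G) :
    ∫⁻ r in Set.Ioi 0, ENNReal.ofReal (r ^ (a - 1)) *
        (ENNReal.ofReal ((1 + r ^ 2) ^ (-(a + b) / 2)) * G (r ^ 2)) =
      ENNReal.ofReal (beta (a / 2) (b / 2) / 2) * ∫⁻ y, G (a * y / b) ∂fisherF a b := by
  have hβ : 0 < beta (a / 2) (b / 2) := beta_pos (by positivity) (by positivity)
  have hdens : Measurable fun y : ℝ => if 0 < y then (beta (a / 2) (b / 2))⁻¹ *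
      (a / b) ^ (a / 2) * y ^ (a / 2 - 1) * (1 + a / b * y) ^ (-(a + b) / 2) else 0 :=
    Measurable.ite measurableSet_Ioi (by fun_prop) measurable_const
  rw [lintegral_Ioi_rpow_mul_comp_sq (div_pos ha hb) a
      (fun t => ENNReal.ofReal ((1 + t) ^ (-(a + b) / 2)) * G t), fisherF,
    lintegral_withDensity_eq_lintegral_mul _ hdens.ennreal_ofReal (by fun_prop),
    ← lintegral_const_mul' _ _ ENNReal.ofReal_ne_top, ← lintegral_indicator measurableSet_Ioi]
  refine lintegral_congr fun y => ?_
  by_cases hy : 0 < y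
  · rw [Set.indicator_of_mem (Set.mem_Ioi.2 hy), Pi.mul_apply, if_pos hy, ← mul_assoc,
      ← mul_assoc, ← ENNReal.ofReal_mul (by positivity), ← ENNReal.ofReal_mul (by positivity)]
    congr 2
    · field_simp
    · ring
  · rw [Set.indicator_of_notMem (by simpa using hy), Pi.mul_apply, if_neg hy]
    simp

lemma ae_pos_fisherF (a b : ℝ) : ∀ᵐ y ∂fisherF a b, 0 < y := by
  have hdens : Measurable fun y : ℝ => ENNReal.ofReal (if 0 < y then (beta (a / 2) (b / 2))⁻¹ *
      (a / b) ^ (a / 2) * y ^ (a / 2 - 1) * (1 + a / b * y) ^ (-(a + b) / 2) else 0) :=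
    (Measurable.ite measurableSet_Ioi (by fun_prop) measurable_const).ennreal_ofReal
  rw [fisherF, ae_withDensity_iff hdens]
  refine ae_of_all _ fun y hy => ?_
  contrapose! hy
  rw [if_neg hy.not_gt, ENNReal.ofReal_zero]

instance sFinite_chiSq (ν : ℝ) : SFinite (chiSq ν) := by
  unfold chiSq gammaMeasure
  infer_instance

instance sFinite_fisherF (a b : ℝ) : SFinite (fisherF a b) := by
  unfold fisherF
  infer_instance

instance sFinite_uniformSphere (k : ℕ) : SFinite (uniformSphere k) := by
  unfold uniformSphere
  infer_instance

lemma toSphere_univ_ne_zero (k : ℕ) [NeZero k] :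
    (volume : Measure (EuclideanSpace ℝ (Fin k))).toSphere Set.univ ≠ 0 :=
  Measure.measure_univ_ne_zero.2 (Measure.toSphere_ne_zero _)

lemma lintegral_toSphere {k : ℕ} [NeZero k] (G : UnitSphere k → ℝ≥0∞) :
    ∫⁻ u, G u ∂(volume : Measure (EuclideanSpace ℝ (Fin k))).toSphere =
      (volume : Measure (EuclideanSpace ℝ (Fin k))).toSphere Set.univ *
        ∫⁻ u, G u ∂uniformSphere k := by
  rw [uniformSphere, lintegral_smul_measure, smul_eq_mul, ← mul_assoc,
    ENNReal.mul_inv_cancel (toSphere_univ_ne_zero k) (measure_ne_top _ _), one_mul]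

end PolarCoordinates

/-! ### The multivariate t-distribution -/

section MultivariateT

lemma dotProduct_self_ofLp_sphere {k : ℕ} (u : UnitSphere k) : u.1.ofLp ⬝ᵥ u.1.ofLp = 1 := by
  rw [← norm_sq_eq_dotProduct, norm_eq_of_mem_sphere u, one_pow]

lemma det_inv_sqrt_smul_sqrt_ne_zero {k : ℕ} {S : Matrix (Fin k) (Fin k) ℝ} (hS : S.PosDef)
    {N : ℝ} (hN : 0 < N) : ((√N)⁻¹ • CFC.sqrt S).det ≠ 0 := by
  rw [det_smul]
  exact mul_ne_zero (pow_ne_zero _ (inv_ne_zero (Real.sqrt_pos.2 hN).ne'))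
    (isUnit_det_sqrt hS).ne_zero

lemma lintegral_det_add_smul_vecMulVec_toSphere {k : ℕ} [NeZero k]
    {S : Matrix (Fin k) (Fin k) ℝ} (hS : S.PosDef) {N : ℝ} (hN : 0 < N) (e : ℝ)
    {F : (Fin k → ℝ) → ℝ≥0∞} (hF : Measurable F) :
    ∫⁻ v, ENNReal.ofReal ((S + N • vecMulVec v v).det ^ e) * F v =
      ENNReal.ofReal (|((√N)⁻¹ • CFC.sqrt S).det| * S.det ^ e) *
        ∫⁻ u : UnitSphere k, (∫⁻ r in Set.Ioi (0 : ℝ), ENNReal.ofReal (r ^ ((k : ℝ) - 1)) *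
          (ENNReal.ofReal ((1 + r ^ 2) ^ e) * F ((√(r ^ 2) / √N) • (CFC.sqrt S *ᵥ u.1.ofLp))))
            ∂(volume : Measure (EuclideanSpace ℝ (Fin k))).toSphere := by
  set T : Matrix (Fin k) (Fin k) ℝ := (√N)⁻¹ • CFC.sqrt S with hT
  let Φ : (Fin k → ℝ) → ℝ≥0∞ := fun v => ENNReal.ofReal ((S + N • vecMulVec v v).det ^ e) * F v
  have hΦ : Measurable Φ := by fun_prop
  have hray (u : UnitSphere k) (r : ℝ) (hr : 0 < r) : Φ (T *ᵥ (r • u.1).ofLp) =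
      ENNReal.ofReal (S.det ^ e) * (ENNReal.ofReal ((1 + r ^ 2) ^ e) *
        F ((√(r ^ 2) / √N) • (CFC.sqrt S *ᵥ u.1.ofLp))) := by
    have hv : T *ᵥ (r • u.1).ofLp = (√(r ^ 2) / √N) • (CFC.sqrt S *ᵥ u.1.ofLp) := by
      rw [hT, smul_mulVec, WithLp.ofLp_smul, mulVec_smul, smul_smul, Real.sqrt_sq hr.le,
        inv_mul_eq_div]
    simp only [Φ, hv, smul_vecMulVec_sqrt_div_sqrt_smul hN (sq_nonneg r),
      det_add_smul_vecMulVec_sqrt hS _ (dotProduct_self_ofLp_sphere u)]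
    rw [Real.mul_rpow hS.det_pos.le (by positivity),
      ENNReal.ofReal_mul (Real.rpow_nonneg hS.det_pos.le _), mul_assoc]
  calc ∫⁻ v, Φ v = ENNReal.ofReal |T.det| * ∫⁻ y : EuclideanSpace ℝ (Fin k), Φ (T *ᵥ y.ofLp) := by
        rw [lintegral_comp_mulVec (det_inv_sqrt_smul_sqrt_ne_zero hS hN) hΦ]
        congr 1
        exact ((PiLp.volume_preserving_ofLp (Fin k)).lintegral_comp
          (f := fun y => Φ (T *ᵥ y)) (by fun_prop)).symm
    _ = _ := by
        rw [lintegral_eq_lintegral_toSphere_lintegral_Ioi _ (by fun_prop),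
          ENNReal.ofReal_mul (abs_nonneg _), mul_assoc,
          ← lintegral_const_mul' (ENNReal.ofReal (S.det ^ e)) _ ENNReal.ofReal_ne_top]
        congr 2 with u
        rw [← lintegral_const_mul' _ _ ENNReal.ofReal_ne_top]
        refine setLIntegral_congr_fun measurableSet_Ioi fun r hr => ?_
        rw [hray u r hr, finrank_euclideanSpace_fin, mul_left_comm, ← Real.rpow_natCast,
          Nat.cast_sub NeZero.one_le, Nat.cast_one]

lemma exists_lintegral_det_add_smul_vecMulVec_rpow {k : ℕ} [NeZero k]
    {S : Matrix (Fin k) (Fin k) ℝ} (hS : S.PosDef) {N δ : ℝ} (hN : 0 < N) (hδ : 0 < δ) :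
    ∃ c : ℝ≥0∞, c ≠ 0 ∧ c ≠ ∞ ∧ ∀ F : (Fin k → ℝ) → ℝ≥0∞, Measurable F →
      ∫⁻ v, ENNReal.ofReal ((S + N • vecMulVec v v).det ^ (-(k + δ) / 2)) * F v =
        c * ∫⁻ u, ∫⁻ y, F ((√(k * y / δ) / √N) • (CFC.sqrt S *ᵥ u.1.ofLp)) ∂fisherF k δ
          ∂uniformSphere k := by
  have hk : 0 < (k : ℝ) := Nat.cast_pos.2 (NeZero.pos k)
  have hβ : 0 < beta (k / 2 : ℝ) (δ / 2) := beta_pos (by positivity) (by positivity)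
  have hT : 0 < |((√N)⁻¹ • CFC.sqrt S).det| :=
    abs_pos.2 (det_inv_sqrt_smul_sqrt_ne_zero hS hN)
  have hSdet : 0 < S.det ^ (-(k + δ) / 2) := Real.rpow_pos_of_pos hS.det_pos _
  refine ⟨ENNReal.ofReal (|((√N)⁻¹ • CFC.sqrt S).det| * S.det ^ (-(k + δ) / 2)) *
    (ENNReal.ofReal (beta (k / 2 : ℝ) (δ / 2) / 2) *
      (volume : Measure (EuclideanSpace ℝ (Fin k))).toSphere Set.univ), ?_, ?_, fun F hF => ?_⟩
  · exact mul_ne_zero (ENNReal.ofReal_ne_zero_iff.2 (by positivity))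
      (mul_ne_zero (ENNReal.ofReal_ne_zero_iff.2 (by positivity)) (toSphere_univ_ne_zero k))
  · exact ENNReal.mul_ne_top ENNReal.ofReal_ne_top
      (ENNReal.mul_ne_top ENNReal.ofReal_ne_top (measure_ne_top _ _))
  · rw [lintegral_det_add_smul_vecMulVec_toSphere hS hN _ hF, mul_assoc, mul_assoc,
      ← lintegral_toSphere, ← lintegral_const_mul' (ENNReal.ofReal (_ / 2)) _ ENNReal.ofReal_ne_top]
    congr 1
    refine lintegral_congr fun u => ?_
    exact lintegral_fisherF hk hδ
      (G := fun q => F ((√q / √N) • (CFC.sqrt S *ᵥ u.1.ofLp))) (by fun_prop)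

end MultivariateT

/-! ### The normal–inverse-Wishart distribution -/

section NormalInvWishart

variable {k p : ℕ}

lemma lintegral_driverLaw {ν d : ℝ} {G : ℝ × EuclideanSpace ℝ (Fin p) × ℝ × UnitSphere k → ℝ≥0∞}
    (hG : Measurable G) :
    ∫⁻ a, G a ∂driverLaw p k ν d =
      ∫⁻ u, ∫⁻ y, ∫⁻ w, ∫⁻ z, G (w, z, y, u) ∂stdGaussian (EuclideanSpace ℝ (Fin p)) ∂chiSq ν
        ∂fisherF k d ∂uniformSphere k := by
  have hz (w : ℝ) : ∫⁻ a, G (w, a) ∂((stdGaussian (EuclideanSpace ℝ (Fin p))).prod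
      ((fisherF k d).prod (uniformSphere k))) =
      ∫⁻ b, ∫⁻ z, G (w, z, b) ∂stdGaussian (EuclideanSpace ℝ (Fin p))
        ∂((fisherF k d).prod (uniformSphere k)) :=
    lintegral_prod_symm _ (by fun_prop)
  rw [driverLaw, lintegral_prod _ hG.aemeasurable]
  simp only [hz]
  rw [lintegral_lintegral_swap (by fun_prop)]
  exact lintegral_prod_symm _ (by fun_prop)

lemma posDef_add_smul_vecMulVec {S : Matrix (Fin k) (Fin k) ℝ} (hS : S.PosDef) {N : ℝ}
    (hN : 0 ≤ N) (v : Fin k → ℝ) : (S + N • vecMulVec v v).PosDef :=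
  hS.add_posSemidef ((posSemidef_vecMulVec_self_star v).smul hN)

/-- The unnormalized normal–inverse-Wishart distribution, with density
`|Σ|^{-d/2} exp(-(N (μ - m)ᵀ Σ⁻¹ (μ - m) + tr(Σ⁻¹ S)) / 2)`: conjugate family of the normal model,
in which `Σ` given `μ` is inverse Wishart. -/
def normalInvWishartMeasure (d N : ℝ) (m : Fin k → ℝ) (S : Matrix (Fin k) (Fin k) ℝ) :
    Measure (Param k) :=
  volume.withDensity fun θ =>
    invWishartWeight d (S + N • vecMulVec (θ.mean - m) (θ.mean - m)) θ.cov

@[fun_prop]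
lemma measurable_mean : Measurable (Param.mean (k := k)) :=
  measurable_fst

@[fun_prop]
lemma measurable_cov : Measurable (Param.cov (k := k)) :=
  measurable_symMatrix.comp measurable_snd

lemma lintegral_normalInvWishartMeasure (d N : ℝ) (m : Fin k → ℝ) (S : Matrix (Fin k) (Fin k) ℝ)
    {F : Param k → ℝ≥0∞} (hF : Measurable F) :
    ∫⁻ θ, F θ ∂normalInvWishartMeasure d N m S =
      ∫⁻ v, ∫⁻ s, F (m + v, s) ∂invWishartMeasure d (S + N • vecMulVec v v) := by
  rw [normalInvWishartMeasure, lintegral_withDensity_eq_lintegral_mul _ (by fun_prop) hF,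
    Measure.volume_eq_prod, lintegral_prod _ (by fun_prop), ← lintegral_add_left_eq_self _ m]
  refine lintegral_congr fun v => ?_
  rw [lintegral_invWishartMeasure _ _ (by fun_prop)]
  simp only [Pi.mul_apply, Param.mean, Param.cov, add_sub_cancel_left]

lemma lintegral_inv_mulVec_normalInvWishartMeasure [NeZero k] {d N : ℝ} (hd : 2 * (k : ℝ) < d)
    (hN : 0 ≤ N) (m ρ : Fin k → ℝ) {S : Matrix (Fin k) (Fin k) ℝ} (hS : S.PosDef)
    (L : Matrix (Fin p) (Fin k) ℝ) {f : (Fin p → ℝ) → ℝ≥0∞} (hf : Measurable f) :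
    ∫⁻ θ, f (L *ᵥ (θ.cov⁻¹ *ᵥ (θ.mean - ρ))) ∂normalInvWishartMeasure d N m S =
      invWishartMeasure d (1 : Matrix (Fin k) (Fin k) ℝ) Set.univ *
        ∫⁻ v, ENNReal.ofReal ((S + N • vecMulVec v v).det ^ (-(d - k - 1) / 2)) *
          ∫⁻ w, ∫⁻ z, f (meanVarianceMixture L
            ((m - ρ + v) ⬝ᵥ ((S + N • vecMulVec v v)⁻¹ *ᵥ (m - ρ + v)))
            ((S + N • vecMulVec v v)⁻¹ *ᵥ (m - ρ + v)) (S + N • vecMulVec v v)⁻¹ w z.ofLp)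
              ∂stdGaussian (EuclideanSpace ℝ (Fin p)) ∂chiSq (d - k - 1) := by
  rw [lintegral_normalInvWishartMeasure _ _ _ _ (by fun_prop),
    ← lintegral_const_mul' _ _ (invWishartMeasure_one_univ_ne hd).2]
  refine lintegral_congr fun v => ?_
  have hA := posDef_add_smul_vecMulVec hS hN v
  have hloc : m + v - ρ = m - ρ + v := by abel
  simp only [Param.mean, Param.cov, hloc]
  rw [lintegral_inv_mulVec_invWishartMeasure hd hA L _ hf,
    invWishartMeasure_univ_eq_det_rpow_mul hA, mul_assoc, mul_left_comm]

theorem exists_map_normalInvWishartMeasure_eq_smul [NeZero k] {d N : ℝ}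
    (hd : 2 * (k : ℝ) + 1 < d) (hN : 0 < N) (m ρ : Fin k → ℝ) {S : Matrix (Fin k) (Fin k) ℝ}
    (hS : S.PosDef) (L : Matrix (Fin p) (Fin k) ℝ) (C : ℝ) :
    ∃ c : ℝ≥0∞, c ≠ 0 ∧ c ≠ ∞ ∧
      (normalInvWishartMeasure d N m S).map
          (fun θ => L *ᵥ (C • (θ.cov⁻¹ *ᵥ (θ.mean - ρ)))) =
        c • (driverLaw p k (d - k - 1) (d - 1 - 2 * k)).map fun a =>
          representation C L (m - ρ) S N a.1 a.2.1.ofLp (k * a.2.2.1 / (d - 1 - 2 * k))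
            a.2.2.2.1.ofLp := by
  have hδ : 0 < d - 1 - 2 * k := by linarith
  have hd' : 2 * (k : ℝ) < d := by linarith
  obtain ⟨c, hc, hc', hpolar⟩ := exists_lintegral_det_add_smul_vecMulVec_rpow hS hN hδ
  obtain ⟨h0, htop⟩ := invWishartMeasure_one_univ_ne hd'
  refine ⟨_ * c, mul_ne_zero h0 hc, ENNReal.mul_ne_top htop hc', Measure.ext_of_lintegral _
    fun f hf => ?_⟩
  rw [lintegral_smul_measure, lintegral_map hf (by fun_prop), lintegral_map hf (by fun_prop),
    lintegral_driverLaw (by fun_prop)]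
  simp only [mulVec_smul]
  rw [lintegral_inv_mulVec_normalInvWishartMeasure hd' hN.le m ρ hS L (f := fun y => f (C • y))
    (by fun_prop), show -(d - k - 1) / 2 = -(k + (d - 1 - 2 * k)) / 2 by ring,
    hpolar _ (by unfold meanVarianceMixture; fun_prop), smul_eq_mul, mul_assoc]
  congr 2
  refine lintegral_congr fun u => lintegral_congr_ae ?_
  filter_upwards [ae_pos_fisherF k (d - 1 - 2 * k)] with y hy
  have hq : 0 ≤ k * y / (d - 1 - 2 * k) := by positivity
  simp only [meanVarianceMixture_rankOne_eq_representation hS hN hq (dotProduct_self_ofLp_sphere u)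
    C L (m - ρ) _ _ rfl]

end NormalInvWishart

/-! ### The posterior distribution -/

section Posterior

variable {k n : ℕ}

lemma smul_sampleMean (x : Fin n → Fin k → ℝ) : (n : ℝ) • sampleMean x = ∑ i, x i := by
  rcases eq_or_ne n 0 with rfl | hn
  · simp
  · rw [sampleMean, smul_inv_smul₀ (Nat.cast_ne_zero.2 hn)]

lemma sum_sub_sampleMean (x : Fin n → Fin k → ℝ) : ∑ i, (x i - sampleMean x) = 0 := by
  rw [Finset.sum_sub_distrib, Finset.sum_const, Finset.card_univ, Fintype.card_fin,
    ← smul_sampleMean, Nat.cast_smul_eq_nsmul, sub_self]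

lemma scaleD_eq_sum_vecMulVec (x : Fin n → Fin k → ℝ) :
    scaleD x = ∑ i, vecMulVec (x i - sampleMean x) (x i - sampleMean x) := by
  rcases eq_or_ne n 1 with rfl | hn
  · simp [scaleD, sampleMean]
  · rw [scaleD, sampleCov, smul_inv_smul₀ (sub_ne_zero.2 (Nat.cast_ne_one.2 hn))]

lemma posSemidef_scaleD (x : Fin n → Fin k → ℝ) : (scaleD x).PosSemidef := by
  rw [scaleD_eq_sum_vecMulVec]
  exact posSemidef_sum _ fun i _ => posSemidef_vecMulVec_self_star _

lemma posDef_scaleC (x : Fin n → Fin k → ℝ) (m₀ : Fin k → ℝ) {r₀ : ℝ} (hr : 0 ≤ r₀)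
    {S₀ : Matrix (Fin k) (Fin k) ℝ} (hS₀ : S₀.PosDef) : (scaleC x m₀ r₀ S₀).PosDef :=
  posDef_add_smul_vecMulVec (hS₀.posSemidef_add (posSemidef_scaleD x)) (by positivity) _

lemma lt_of_posDef_scaleD (hk : 0 < k) {x : Fin n → Fin k → ℝ} (hS : (scaleD x).PosDef) :
    k < n := by
  let V : Matrix (Fin n) (Fin k) ℝ := of fun i => x i - sampleMean x
  have hscale : scaleD x = Vᴴ * V := by
    rw [scaleD_eq_sum_vecMulVec]
    ext a b
    simp [V, Matrix.sum_apply, vecMulVec_apply, mul_apply]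
  have hinj : Function.Injective V.mulVec := by
    refine (injective_iff_map_eq_zero V.mulVecLin).2 fun a ha => ?_
    by_contra ha0
    have hpos := hS.dotProduct_mulVec_pos ha0
    rw [hscale, ← mulVec_mulVec, ← mulVecLin_apply V, ha, mulVec_zero, dotProduct_zero] at hpos
    exact hpos.false
  have hrank : Module.finrank ℝ (LinearMap.range V.mulVecLin) = k := by
    rw [LinearMap.finrank_range_of_inj hinj, Module.finrank_fin_fun]
  have hn : n ≠ 0 := by
    rintro rfl
    exact hk.ne' (by simpa using hrank.symm.trans_le (Submodule.finrank_le _))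
  have hone : (1 : Fin n → ℝ) ᵥ* V = 0 := by
    rw [← sum_sub_sampleMean x, vecMul_eq_sum]
    simp only [Pi.one_apply, one_smul]
    rfl
  have hrange : LinearMap.range V.mulVecLin ≠ ⊤ := fun htop => by
    obtain ⟨a, ha⟩ := htop.ge (Submodule.mem_top (x := (1 : Fin n → ℝ)))
    have hcard : (1 : Fin n → ℝ) ⬝ᵥ (V *ᵥ a) = n := by
      rw [← mulVecLin_apply, ha]
      simp
    rw [dotProduct_mulVec, hone, zero_dotProduct] at hcard
    exact hn (Nat.cast_eq_zero.1 hcard.symm)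
  simpa [hrank] using Submodule.finrank_lt hrange

lemma sum_vecMulVec_sub (x : Fin n → Fin k → ℝ) (μ : Fin k → ℝ) :
    ∑ i, vecMulVec (x i - μ) (x i - μ) =
      scaleD x + (n : ℝ) • vecMulVec (μ - sampleMean x) (μ - sampleMean x) := by
  have hsplit (i : Fin n) : vecMulVec (x i - μ) (x i - μ) =
      vecMulVec (x i - sampleMean x) (x i - sampleMean x) -
        vecMulVec (x i - sampleMean x) (μ - sampleMean x) -
        vecMulVec (μ - sampleMean x) (x i - sampleMean x) +
        vecMulVec (μ - sampleMean x) (μ - sampleMean x) := by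
    ext a b
    simp only [Matrix.add_apply, Matrix.sub_apply, vecMulVec_apply, Pi.sub_apply]
    ring
  have hcross (v : Fin k → ℝ) : ∑ i, vecMulVec (x i - sampleMean x) v = 0 := by
    rw [← zero_vecMulVec v, ← sum_sub_sampleMean x]
    ext a b
    simp only [Matrix.sum_apply, vecMulVec_apply, Finset.sum_apply, Finset.sum_mul]
  have hcross' (v : Fin k → ℝ) : ∑ i, vecMulVec v (x i - sampleMean x) = 0 := by
    simpa only [transpose_sum, transpose_vecMulVec, transpose_zero] using
      congrArg transpose (hcross v)
  simp only [hsplit, Finset.sum_add_distrib, Finset.sum_sub_distrib, hcross, hcross', sub_zero,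
    ← scaleD_eq_sum_vecMulVec, Finset.sum_const, Finset.card_univ, Fintype.card_fin,
    Nat.cast_smul_eq_nsmul]

lemma scaleC_add_smul_vecMulVec (x : Fin n → Fin k → ℝ) (m₀ : Fin k → ℝ) {r₀ : ℝ} (hr : 0 < r₀)
    (S₀ : Matrix (Fin k) (Fin k) ℝ) (μ : Fin k → ℝ) :
    scaleC x m₀ r₀ S₀ + ((n : ℝ) + r₀) • vecMulVec (μ - meanC x m₀ r₀) (μ - meanC x m₀ r₀) =
      (scaleD x + (n : ℝ) • vecMulVec (μ - sampleMean x) (μ - sampleMean x)) +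
        r₀ • vecMulVec (μ - m₀) (μ - m₀) + S₀ := by
  have hnr : (n : ℝ) + r₀ ≠ 0 := by positivity
  ext a b
  simp only [scaleC, meanC, Matrix.add_apply, Matrix.smul_apply, vecMulVec_apply, Pi.sub_apply,
    Pi.smul_apply, Pi.add_apply, smul_eq_mul]
  field_simp
  ring

lemma normalDensity_eq_exp_trace (m : Fin k → ℝ) (V : Matrix (Fin k) (Fin k) ℝ) (y : Fin k → ℝ) :
    normalDensity m V y = (2 * Real.pi) ^ (-(k : ℝ) / 2) * V.det ^ (-(1 : ℝ) / 2) *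
      Real.exp (-(V⁻¹ * vecMulVec (y - m) (y - m)).trace / 2) := by
  rw [normalDensity, mul_vecMulVec, trace_vecMulVec, dotProduct_comm]

lemma likelihood_eq (x : Fin n → Fin k → ℝ) {θ : Param k} (hθ : θ.cov.PosDef) :
    likelihood x θ = ((2 * Real.pi) ^ (-(k : ℝ) / 2)) ^ n * θ.cov.det ^ (-(n : ℝ) / 2) *
      Real.exp (-(θ.cov⁻¹ * (scaleD x +
        (n : ℝ) • vecMulVec (θ.mean - sampleMean x) (θ.mean - sampleMean x))).trace / 2) := by
  have hdet : (θ.cov.det ^ (-(1 : ℝ) / 2)) ^ n = θ.cov.det ^ (-(n : ℝ) / 2) := by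
    rw [← Real.rpow_natCast, ← Real.rpow_mul hθ.det_pos.le]
    ring_nf
  simp only [likelihood, normalDensity_eq_exp_trace, Finset.prod_mul_distrib, Finset.prod_const,
    Finset.card_univ, Fintype.card_fin, hdet, ← Real.exp_sum, ← sum_vecMulVec_sub,
    Matrix.mul_sum, trace_sum, Finset.sum_neg_distrib, ← Finset.sum_div]

lemma normalDensity_inv_smul {V : Matrix (Fin k) (Fin k) ℝ} (hV : V.PosDef) {r : ℝ} (hr : 0 < r)
    (m y : Fin k → ℝ) :
    normalDensity m (r⁻¹ • V) y = (2 * Real.pi) ^ (-(k : ℝ) / 2) * (r⁻¹ ^ k) ^ (-(1 : ℝ) / 2) *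
      V.det ^ (-(1 : ℝ) / 2) *
        Real.exp (-(V⁻¹ * (r • vecMulVec (y - m) (y - m))).trace / 2) := by
  have hinv : (r⁻¹ • V)⁻¹ = r • V⁻¹ := by
    refine inv_eq_right_inv ?_
    rw [Matrix.smul_mul, Matrix.mul_smul, smul_smul, inv_mul_cancel₀ hr.ne', one_smul,
      mul_nonsing_inv _ hV.det_pos.ne'.isUnit]
  rw [normalDensity_eq_exp_trace, hinv, det_smul, Fintype.card_fin,
    Real.mul_rpow (by positivity) hV.det_pos.le, Matrix.smul_mul, Matrix.mul_smul, mul_assoc _ _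
      (V.det ^ _)]

lemma multivariateGamma_pos {a : ℝ} (ha : ((k : ℝ) - 1) / 2 < a) : 0 < multivariateGamma k a := by
  refine mul_pos (by positivity) (Finset.prod_pos fun i _ => Real.Gamma_pos_of_pos ?_)
  have hi : ((i : ℕ) : ℝ) + 1 ≤ k := by exact_mod_cast i.2
  linarith

lemma unnormalizedPosterior_eq_smul_normalInvWishartMeasure {prior : Param k → ℝ}
    {x : Fin n → Fin k → ℝ} {K d N : ℝ} (hK : 0 ≤ K) {m : Fin k → ℝ}
    {S : Matrix (Fin k) (Fin k) ℝ}
    (h : ∀ θ : Param k, θ.cov.PosDef → likelihood x θ * prior θ =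
      K * (θ.cov.det ^ (-d / 2) * Real.exp (-(θ.cov⁻¹ * (S +
        N • vecMulVec (θ.mean - m) (θ.mean - m))).trace / 2))) :
    unnormalizedPosterior prior x = ENNReal.ofReal K • normalInvWishartMeasure d N m S := by
  have hposDef : MeasurableSet {θ : Param k | θ.cov.PosDef} := measurable_cov measurableSet_posDef
  rw [unnormalizedPosterior, paramVolume, ← withDensity_indicator hposDef,
    normalInvWishartMeasure, ← withDensity_smul _ (by fun_prop)]
  congr 1 with θ
  by_cases hθ : θ.cov.PosDef
  · rw [Set.indicator_of_mem (by exact hθ), h θ hθ, ENNReal.ofReal_mul hK, Pi.smul_apply,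
      invWishartWeight_of_posDef hθ, smul_eq_mul]
  · rw [Set.indicator_of_notMem (by exact hθ), Pi.smul_apply, invWishartWeight_of_not_posDef hθ,
      smul_zero]

lemma exists_unnormalizedPosterior_diffusePrior_eq_smul (x : Fin n → Fin k → ℝ) :
    ∃ c : ℝ≥0∞, c ≠ 0 ∧ c ≠ ∞ ∧ unnormalizedPosterior (diffusePrior k) x =
      c • normalInvWishartMeasure (n + k + 1) n (sampleMean x) (scaleD x) := by
  have hK : 0 < ((2 * Real.pi) ^ (-(k : ℝ) / 2)) ^ n := by positivity
  refine ⟨_, ENNReal.ofReal_ne_zero_iff.2 hK, ENNReal.ofReal_ne_top,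
    unnormalizedPosterior_eq_smul_normalInvWishartMeasure hK.le fun θ hθ => ?_⟩
  have hdet : θ.cov.det ^ (-((n : ℝ) + k + 1) / 2) =
      θ.cov.det ^ (-(n : ℝ) / 2) * θ.cov.det ^ (-((k : ℝ) + 1) / 2) := by
    rw [← Real.rpow_add hθ.det_pos]
    ring_nf
  rw [likelihood_eq x hθ, diffusePrior, hdet]
  ring

lemma exists_unnormalizedPosterior_conjugatePrior_eq_smul (x : Fin n → Fin k → ℝ)
    (m₀ : Fin k → ℝ) {r₀ d₀ : ℝ} (hr : 0 < r₀) (hd : 2 * (k : ℝ) < d₀)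
    {S₀ : Matrix (Fin k) (Fin k) ℝ} (hS₀ : S₀.PosDef) :
    ∃ c : ℝ≥0∞, c ≠ 0 ∧ c ≠ ∞ ∧ unnormalizedPosterior (conjugatePrior m₀ r₀ d₀ S₀) x =
      c • normalInvWishartMeasure (n + d₀ + 1) (n + r₀) (meanC x m₀ r₀) (scaleC x m₀ r₀ S₀) := by
  have hΓ : 0 < multivariateGamma k ((d₀ - k - 1) / 2) := multivariateGamma_pos (by linarith)
  have hS₀det := hS₀.det_pos
  have hK : 0 < ((2 * Real.pi) ^ (-(k : ℝ) / 2)) ^ n * ((2 * Real.pi) ^ (-(k : ℝ) / 2) *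
      (r₀⁻¹ ^ k) ^ (-(1 : ℝ) / 2) * (S₀.det ^ ((d₀ - k - 1) / 2) /
        (2 ^ ((d₀ - k - 1) * k / 2) * multivariateGamma k ((d₀ - k - 1) / 2)))) := by
    positivity
  refine ⟨_, ENNReal.ofReal_ne_zero_iff.2 hK, ENNReal.ofReal_ne_top,
    unnormalizedPosterior_eq_smul_normalInvWishartMeasure hK.le fun θ hθ => ?_⟩
  have hdet : θ.cov.det ^ (-((n : ℝ) + d₀ + 1) / 2) = θ.cov.det ^ (-(n : ℝ) / 2) *
      (θ.cov.det ^ (-(1 : ℝ) / 2) * θ.cov.det ^ (-d₀ / 2)) := by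
    rw [← Real.rpow_add hθ.det_pos, ← Real.rpow_add hθ.det_pos]
    ring_nf
  have hexp (a b c : ℝ) : Real.exp (-(a + b + c) / 2) =
      Real.exp (-a / 2) * Real.exp (-b / 2) * Real.exp (-c / 2) := by
    rw [← Real.exp_add, ← Real.exp_add]
    ring_nf
  rw [scaleC_add_smul_vecMulVec x m₀ hr, Matrix.mul_add, Matrix.mul_add, trace_add, trace_add,
    hexp, likelihood_eq x hθ, conjugatePrior, normalDensity_inv_smul hθ hr, invWishartDensity,
    hdet]
  ring

lemma inv_measure_univ_smul_eq_of_eq_smul {α : Type*} [MeasurableSpace α] {μ ν : Measure α}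
    [IsProbabilityMeasure ν] {c : ℝ≥0∞} (hc : c ≠ 0) (hc' : c ≠ ∞) (h : μ = c • ν) :
    (μ Set.univ)⁻¹ • μ = ν := by
  rw [h, Measure.smul_apply, measure_univ, smul_eq_mul, mul_one, smul_smul,
    ENNReal.inv_mul_cancel hc hc', one_smul]

theorem identDistrib_posteriorDist_representation {p : ℕ} [NeZero k] {d N : ℝ}
    (hd : 2 * (k : ℝ) + 1 < d) (hN : 0 < N) {m : Fin k → ℝ} {S : Matrix (Fin k) (Fin k) ℝ}
    (hS : S.PosDef) {prior : Param k → ℝ} {x : Fin n → Fin k → ℝ}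
    (hpost : ∃ c : ℝ≥0∞, c ≠ 0 ∧ c ≠ ∞ ∧
      unnormalizedPosterior prior x = c • normalInvWishartMeasure d N m S)
    (L : Matrix (Fin p) (Fin k) ℝ) (C : ℝ) (ρ : Fin k → ℝ)
    {Ω : Type*} [MeasurableSpace Ω] {P : Measure Ω} [IsProbabilityMeasure P]
    {η : Ω → ℝ} {z₀ : Ω → EuclideanSpace ℝ (Fin p)} {Q : Ω → ℝ} {u : Ω → UnitSphere k}
    (hX : HasLaw (fun ω => (η ω, z₀ ω, Q ω, u ω))
      (driverLaw p k (d - k - 1) (d - 1 - 2 * k)) P) :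
    IdentDistrib (fun θ => L *ᵥ (C • (θ.cov⁻¹ *ᵥ (θ.mean - ρ))))
      (fun ω => representation C L (m - ρ) S N (η ω) (z₀ ω).ofLp (k * Q ω / (d - 1 - 2 * k))
        (u ω).1.ofLp)
      (posteriorDist prior x) P := by
  obtain ⟨c₁, hc₁, hc₁', hpost⟩ := hpost
  obtain ⟨c₂, hc₂, hc₂', hlaw⟩ :=
    exists_map_normalInvWishartMeasure_eq_smul hd hN m ρ hS L C
  set w : Param k → Fin p → ℝ := fun θ => L *ᵥ (C • (θ.cov⁻¹ *ᵥ (θ.mean - ρ)))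
  set g : ℝ × EuclideanSpace ℝ (Fin p) × ℝ × UnitSphere k → Fin p → ℝ := fun a =>
    representation C L (m - ρ) S N a.1 a.2.1.ofLp (k * a.2.2.1 / (d - 1 - 2 * k)) a.2.2.2.1.ofLp
  have hw : Measurable w := by fun_prop
  have hg : Measurable g := by fun_prop
  have hgX := hg.comp_aemeasurable hX.aemeasurable
  have hmap : (driverLaw p k (d - k - 1) (d - 1 - 2 * k)).map g =
      P.map (g ∘ fun ω => (η ω, z₀ ω, Q ω, u ω)) := by
    rw [← hX.map_eq, AEMeasurable.map_map_of_aemeasurable hg.aemeasurable hX.aemeasurable]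
  have : IsProbabilityMeasure (P.map (g ∘ fun ω => (η ω, z₀ ω, Q ω, u ω))) :=
    Measure.isProbabilityMeasure_map hgX
  refine ⟨hw.aemeasurable, hgX, ?_⟩
  change _ = P.map (g ∘ fun ω => (η ω, z₀ ω, Q ω, u ω))
  rw [posteriorDist, Measure.map_smul, ← Set.preimage_univ (f := w),
    ← Measure.map_apply hw .univ]
  refine inv_measure_univ_smul_eq_of_eq_smul (mul_ne_zero hc₁ hc₂)
    (ENNReal.mul_ne_top hc₁' hc₂') ?_
  rw [hpost, Measure.map_smul, hlaw, smul_smul, hmap]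

end Posterior

end BayesPortfolio

end

theorem theorem2_general {k p n : ℕ} (hk : 0 < k) (x : Fin n → Fin k → ℝ)
    (L : Matrix (Fin p) (Fin k) ℝ) (C : ℝ) (ρ : Fin k → ℝ)
    {Ω : Type*} [MeasurableSpace Ω] (P : Measure Ω) [IsProbabilityMeasure P]
    (η : Ω → ℝ) (z₀ : Ω → EuclideanSpace ℝ (Fin p)) (Q : Ω → ℝ) (u : Ω → UnitSphere k) :
    ((scaleD x).PosDef →
      HasLaw (fun ω => (η ω, z₀ ω, Q ω, u ω)) (driverLaw p k n ((n : ℝ) - k)) P →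
      IdentDistrib (fun θ : Param k => L *ᵥ (C • (θ.cov⁻¹ *ᵥ (θ.mean - ρ))))
        (fun ω => representation C L (sampleMean x - ρ) (scaleD x) n
          (η ω) (z₀ ω).ofLp (k * Q ω / ((n : ℝ) - k)) (u ω).1.ofLp)
        (posteriorDist (diffusePrior k) x) P) ∧
    (∀ (m₀ : Fin k → ℝ) (r₀ d₀ : ℝ) (S₀ : Matrix (Fin k) (Fin k) ℝ),
      0 < r₀ → 2 * (k : ℝ) < d₀ → S₀.PosDef →
      HasLaw (fun ω => (η ω, z₀ ω, Q ω, u ω))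
        (driverLaw p k ((n : ℝ) + d₀ - k) ((n : ℝ) + d₀ - 2 * k)) P →
      IdentDistrib (fun θ : Param k => L *ᵥ (C • (θ.cov⁻¹ *ᵥ (θ.mean - ρ))))
        (fun ω => representation C L (meanC x m₀ r₀ - ρ) (scaleC x m₀ r₀ S₀) ((n : ℝ) + r₀)
          (η ω) (z₀ ω).ofLp (k * Q ω / ((n : ℝ) + d₀ - 2 * k)) (u ω).1.ofLp)
        (posteriorDist (conjugatePrior m₀ r₀ d₀ S₀) x) P) := by
  have : NeZero k := ⟨hk.ne'⟩
  refine ⟨fun hS hX => ?_, fun m₀ r₀ d₀ S₀ hr hd hS₀ hX => ?_⟩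
  · have hkn : (k : ℝ) < n := Nat.cast_lt.2 (lt_of_posDef_scaleD hk hS)
    have hdof : (n : ℝ) = n + k + 1 - k - 1 := by ring
    have hdofF : (n : ℝ) - k = n + k + 1 - 1 - 2 * k := by ring
    rw [hdofF] at hX ⊢
    exact identDistrib_posteriorDist_representation (by linarith)
      (k.cast_nonneg.trans_lt hkn) hS (exists_unnormalizedPosterior_diffusePrior_eq_smul x) L C ρ
      (by rwa [← hdof])
  · have hn : (0 : ℝ) ≤ n := n.cast_nonneg
    have hdof : (n : ℝ) + d₀ - k = n + d₀ + 1 - k - 1 := by ring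
    have hdofF : (n : ℝ) + d₀ - 2 * k = n + d₀ + 1 - 1 - 2 * k := by ring
    rw [hdof, hdofF] at hX
    rw [hdofF]
    exact identDistrib_posteriorDist_representation (by linarith) (by positivity)
      (posDef_scaleC x m₀ hr.le hS₀)
      (exists_unnormalizedPosterior_conjugatePrior_eq_smul x m₀ hr hd hS₀) L C ρ hX

theorem theorem2 {k p n : ℕ} (hk : 0 < k) (hkn : k < n)
    (x : Fin n → Fin k → ℝ) (L : Matrix (Fin p) (Fin k) ℝ)
    (γ W : ℝ) (hγ : 0 < γ) (rf : ℕ → ℝ) (t T : ℕ) (ht : t < T)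
    {Ω : Type*} [MeasurableSpace Ω] (P : Measure Ω) [IsProbabilityMeasure P]
    (η : Ω → ℝ) (z₀ : Ω → EuclideanSpace ℝ (Fin p)) (Q : Ω → ℝ) (u : Ω → UnitSphere k) :
    -- diffuse prior
    ((scaleD x).PosDef →
      HasLaw (fun ω => (η ω, z₀ ω, Q ω, u ω)) (driverLaw p k n ((n : ℝ) - k)) P →
      IdentDistrib (fun θ => L *ᵥ weights γ W rf t T θ)
        (fun ω => representation (portfolioConst γ W rf t T) L
          (sampleMean x - fun _ => rf (t + 1)) (scaleD x) n
          (η ω) (z₀ ω).ofLp (k * Q ω / ((n : ℝ) - k)) (u ω).1.ofLp)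
        (posteriorDist (diffusePrior k) x) P) ∧
    -- conjugate prior
    (∀ (m₀ : Fin k → ℝ) (r₀ d₀ : ℝ) (S₀ : Matrix (Fin k) (Fin k) ℝ),
      0 < r₀ → 2 * (k : ℝ) < d₀ → S₀.PosDef →
      HasLaw (fun ω => (η ω, z₀ ω, Q ω, u ω))
        (driverLaw p k ((n : ℝ) + d₀ - k) ((n : ℝ) + d₀ - 2 * k)) P →
      IdentDistrib (fun θ => L *ᵥ weights γ W rf t T θ)
        (fun ω => representation (portfolioConst γ W rf t T) L
          (meanC x m₀ r₀ - fun _ => rf (t + 1)) (scaleC x m₀ r₀ S₀) ((n : ℝ) + r₀)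
          (η ω) (z₀ ω).ofLp (k * Q ω / ((n : ℝ) + d₀ - 2 * k)) (u ω).1.ofLp)
        (posteriorDist (conjugatePrior m₀ r₀ d₀ S₀) x) P) :=
  theorem2_general hk x L (portfolioConst γ W rf t T) (fun _ => rf (t + 1)) P η z₀ Q u
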